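/- Let $\beta>0$ and let $\widehat f:\mathbb R\to\mathbb C$ satisfy $\overline{\widehat f(\nu)}=\widehat f(-\nu)e^{-\beta\nu/2}$ for all $\nu\in\mathbb R$, $\sup_\nu|\widehat f(\nu)|<\infty$, $\sup_\nu e^{\beta\nu/2}|\widehat f(\nu)|<\infty$, and $\widehat f(1)\neq 0$. Let $\mathcal H$ be a complex Hilbert space with an orthonormal (Fock) basis $(|n\rangle)_{n\in\mathbb N}$ (for instance $L^2(\mathbb R)$ with the Hermite functions), let $a|n\rangle=\sqrt n\,|n-1\rangle$, $a^\dagger|n\rangle=\sqrt{n+1}\,|n+1\rangle$, $N=a^\dagger a$, and let $\mathscr T_1(\mathcal H)$ be the space of trace-class operators with the trace norm $\|x\|_1=\operatorname{Tr}|x|$. With $H=N$, $P_k=|k\rangle\langle k|$ and jumps $A\in\{a,a^\dagger\}$ put $$L^A|i\rangle=\sum_{k}\widehat f(k-i)P_kA|i\rangle,\qquad G|i\rangle=-\sum_{A\in\{a,a^\dagger\}}\sum_{k,l}\frac{\overline{\widehat f(k-l)}\,\widehat f(k-i)\,e^{\beta(i-l)/4}}{2\cosh(\beta(i-l)/4)}P_lA^\dagger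 P_kA|i\rangle ,$$ $$\mathcal L(|i\rangle\langle j|)=\sum_{A\in\{a,a^\dagger\}}L^A|i\rangle\,(L^A|j\rangle)^\dagger+G|i\rangle\langle j|+|i\rangle(G|j\rangle)^\dagger\qquad(i,j\in\mathbb N);$$ that is, on the span of the $|i\rangle\langle j|$, $$\mathcal L(\rho)=|\widehat f(1)|^2\Big(a^\dagger\rho a-\tfrac12\{aa^\dagger,\rho\}\Big)+|\widehat f(-1)|^2\Big(a\rho a^\dagger-\tfrac12\{a^\dagger a,\rho\}\Big).$$ Then there is exactly one strongly continuous semigroup of bounded operators on $\mathscr T_1(\mathcal H)$ whose generator is defined on every $|i\rangle\langle j|$ and takes there the value $\mathcal L(|i\rangle\langle j|)$; it is a contraction semigroup. Its generator, the quantum Ornstein–Uhlenbeck generator $\mathcal L_{\widehat f,N}$, has as its spectrum on $\mathscr T_1(\mathcal H)$ the entire closed left half-plane, $$\operatorname{Sp}(\mathcal L_{\widehat f,N})=\{z\in\mathbb C:\operatorname{Re}z\le 0\}.$$ In particular $\mathcal L_{\widehat f,N}$ has no spectral gap on $\mathscr T_1(\mathcal H)$: there is no $\lambda_0<0$ such that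 $\operatorname{Re}\lambda\le\lambda_0$ for all $\lambda\in\operatorname{Sp}(\mathcal L_{\widehat f,N})\setminus\{0\}$. Here the spectrum of an operator $(A,D(A))$ is the complement of the set of $\lambda\in\mathbb C$ for which $A-\lambda I$ has a bounded inverse $B:\mathscr T_1(\mathcal H)\to D(A)$. -/

import Mathlib

open Filter Topology
open scoped ENNReal NNReal InnerProductSpace ComplexConjugate

/-! ### Trace-class operators

`𝓗` is a complex Hilbert space with an orthonormal basis `b`, indexed by `ℕ`. -/

noncomputable section TraceClassOperators

set_option linter.unusedSectionVars false

variable {𝓗 : Type*} [NormedAddCommGroup 𝓗] [InnerProductSpace ℂ 𝓗] [CompleteSpace 𝓗]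

/-- The trace norm `Tr |T| = ∑ₙ ⟨bₙ, |T| bₙ⟩ ∈ [0, ∞]`, where `|T| = (T† T)^{1/2}`. -/
def eTraceNorm (b : HilbertBasis ℕ ℂ 𝓗) (T : 𝓗 →L[ℂ] 𝓗) : ℝ≥0∞ :=
  ∑' n, ENNReal.ofReal (RCLike.re ⟪b n, CFC.abs T (b n)⟫_ℂ)

theorem re_inner_real_smul_right (x y : 𝓗) (r : ℝ) :
    RCLike.re ⟪x, r • y⟫_ℂ = r * RCLike.re ⟪x, y⟫_ℂ := by
  rw [← RCLike.real_smul_eq_coe_smul (K := ℂ) r y |>.symm, inner_smul_right]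
  simp

/-- The squared Hilbert-Schmidt norm, an auxiliary quantity for the triangle inequality. -/
def eHilbertSchmidtSq (b : HilbertBasis ℕ ℂ 𝓗) (S : 𝓗 →L[ℂ] 𝓗) : ℝ≥0∞ :=
  ∑' n, ENNReal.ofReal (‖S (b n)‖ ^ 2)

theorem ofReal_normSq_eq_tsum (b : HilbertBasis ℕ ℂ 𝓗) (x : 𝓗) :
    ENNReal.ofReal (‖x‖ ^ 2) = ∑' m, ENNReal.ofReal (‖⟪b m, x⟫_ℂ‖ ^ 2) := by
  have h : HasSum (fun m => ‖⟪b m, x⟫_ℂ‖ ^ 2) (‖x‖ ^ 2) := by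
    have h1 := b.hasSum_inner_mul_inner x x
    have h2 := Complex.hasSum_re h1
    have e1 : (⟪x, x⟫_ℂ).re = ‖x‖ ^ 2 := by
      rw [inner_self_eq_norm_sq_to_K]; norm_cast
    have e2 : (fun m => (⟪x, b m⟫_ℂ * ⟪b m, x⟫_ℂ).re) = fun m => ‖⟪b m, x⟫_ℂ‖ ^ 2 := by
      funext m
      rw [← inner_conj_symm x (b m), Complex.conj_mul']
      norm_cast
    rw [e1] at h2
    rwa [e2] at h2
  rw [← h.tsum_eq, ENNReal.ofReal_tsum_of_nonneg (fun _ => by positivity) h.summable]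

theorem eHilbertSchmidtSq_adjoint (b : HilbertBasis ℕ ℂ 𝓗) (S : 𝓗 →L[ℂ] 𝓗) :
    eHilbertSchmidtSq b (star S) = eHilbertSchmidtSq b S := by
  unfold eHilbertSchmidtSq
  simp_rw [ofReal_normSq_eq_tsum b]
  rw [ENNReal.tsum_comm]
  refine tsum_congr fun m => tsum_congr fun n => ?_
  rw [ContinuousLinearMap.star_eq_adjoint, ContinuousLinearMap.adjoint_inner_right,
    norm_inner_symm]

theorem eHilbertSchmidtSq_mul_left_le (b : HilbertBasis ℕ ℂ 𝓗) (W S : 𝓗 →L[ℂ] 𝓗)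
    (hW : ‖W‖ ≤ 1) : eHilbertSchmidtSq b (W * S) ≤ eHilbertSchmidtSq b S := by
  refine ENNReal.tsum_le_tsum fun n => ENNReal.ofReal_le_ofReal ?_
  have : ‖W (S (b n))‖ ≤ ‖S (b n)‖ := W.le_of_opNorm_le_of_le hW le_rfl |>.trans (by simp)
  exact pow_le_pow_left₀ (norm_nonneg _) this 2

theorem eHilbertSchmidtSq_mul_right_le (b : HilbertBasis ℕ ℂ 𝓗) (S W : 𝓗 →L[ℂ] 𝓗)
    (hW : ‖W‖ ≤ 1) : eHilbertSchmidtSq b (S * W) ≤ eHilbertSchmidtSq b S := by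
  rw [← eHilbertSchmidtSq_adjoint b (S * W), ← eHilbertSchmidtSq_adjoint b S, star_mul]
  exact eHilbertSchmidtSq_mul_left_le b _ _ (by rwa [norm_star])

theorem re_inner_abs_eq (T : 𝓗 →L[ℂ] 𝓗) (x : 𝓗) :
    RCLike.re ⟪x, CFC.abs T x⟫_ℂ = ‖CFC.sqrt (CFC.abs T) x‖ ^ 2 := by
  have h0 : IsSelfAdjoint (CFC.sqrt (CFC.abs T)) := (CFC.sqrt_nonneg _).isSelfAdjoint
  have h : CFC.sqrt (CFC.abs T) * CFC.sqrt (CFC.abs T) = CFC.abs T :=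
    CFC.sqrt_mul_sqrt_self _ (CFC.abs_nonneg T)
  conv_lhs => rw [← h]
  rw [mul_apply_eq_comp, ← ContinuousLinearMap.adjoint_inner_left,
    ← ContinuousLinearMap.star_eq_adjoint, h0.star_eq, inner_self_eq_norm_sq]

theorem eTraceNorm_eq (b : HilbertBasis ℕ ℂ 𝓗) (T : 𝓗 →L[ℂ] 𝓗) :
    eTraceNorm b T = eHilbertSchmidtSq b (CFC.sqrt (CFC.abs T)) := by
  unfold eTraceNorm eHilbertSchmidtSq
  simp_rw [re_inner_abs_eq]

/-- Approximate polar decomposition. -/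
theorem exists_approx_polar (T : 𝓗 →L[ℂ] 𝓗) {ε : ℝ} (hε : 0 < ε) :
    ∃ U : 𝓗 →L[ℂ] 𝓗, ‖U‖ ≤ 1 ∧ ‖T - U * CFC.abs T‖ ≤ ε ∧
      CFC.abs T ≤ star U * T + algebraMap ℝ (𝓗 →L[ℂ] 𝓗) ε := by
  set P := CFC.abs T with hP
  have hP0 : 0 ≤ P := CFC.abs_nonneg T
  have hsa : IsSelfAdjoint P := hP0.isSelfAdjoint
  have hsp : ∀ x ∈ spectrum ℝ P, 0 ≤ x := fun x hx => spectrum_nonneg_of_nonneg hP0 hx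
  have hne : ∀ x ∈ spectrum ℝ P, x + ε ≠ 0 := fun x hx => by have := hsp x hx; positivity
  have hg : ContinuousOn (fun x : ℝ => (x + ε)⁻¹) (spectrum ℝ P) :=
    ContinuousOn.inv₀ (by fun_prop) hne
  set Q := cfc (fun x : ℝ => (x + ε)⁻¹) P with hQ
  have hQsa : star Q = Q := (cfc_predicate (fun x : ℝ => (x + ε)⁻¹) P).star_eq
  have hPid : cfc (fun x : ℝ => x) P = P := cfc_id' ℝ P
  have hPP : star T * T = P * P := (CFC.abs_mul_abs T).symm
  have hQP : Q * P = cfc (fun x : ℝ => (x + ε)⁻¹ * x) P := by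
    rw [cfc_mul (fun x : ℝ => (x + ε)⁻¹) (fun x : ℝ => x) P hg (by fun_prop), hPid]
  have hPQ : P * Q = cfc (fun x : ℝ => x * (x + ε)⁻¹) P := by
    rw [cfc_mul (fun x : ℝ => x) (fun x : ℝ => (x + ε)⁻¹) P (by fun_prop) hg, hPid]
  have hU : ‖T * Q‖ ≤ 1 := by
    have h1 : star (T * Q) * (T * Q) =
        cfc (fun x : ℝ => ((x + ε)⁻¹ * x) * (x * (x + ε)⁻¹)) P := by
      rw [cfc_mul (fun x : ℝ => (x + ε)⁻¹ * x) (fun x : ℝ => x * (x + ε)⁻¹) P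
        (hg.mul (by fun_prop)) (ContinuousOn.mul (by fun_prop) hg), ← hQP, ← hPQ, star_mul, hQsa,
        mul_assoc, ← mul_assoc (star T), hPP]
      simp only [mul_assoc]
    have h2 : ‖star (T * Q) * (T * Q)‖ ≤ 1 := by
      rw [h1]
      refine norm_cfc_le zero_le_one fun x hx => ?_
      have hx0 := hsp x hx
      have h3 : (x + ε)⁻¹ * x ≤ 1 := by
        rw [inv_mul_le_iff₀ (by positivity)]; linarith
      have h4 : 0 ≤ (x + ε)⁻¹ * x := by positivity
      rw [Real.norm_of_nonneg (by positivity), mul_comm x]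
      nlinarith
    rw [CStarRing.norm_star_mul_self] at h2
    nlinarith [norm_nonneg (T * Q)]
  refine ⟨T * Q, hU, ?_, ?_⟩
  · have h1 : T - T * Q * P = ε • (T * Q) := by
      have h2 : (1 : 𝓗 →L[ℂ] 𝓗) = Q * P + ε • Q := by
        rw [hQP, hQ, ← cfc_smul ε (fun x : ℝ => (x + ε)⁻¹) P hg,
          ← cfc_add (a := P) (fun x : ℝ => (x + ε)⁻¹ * x) (fun x : ℝ => ε • (x + ε)⁻¹)
            (hg.mul (by fun_prop)) (hg.const_smul ε), ← cfc_const_one ℝ P]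
        refine cfc_congr fun x hx => ?_
        have := hne x hx
        simp only [smul_eq_mul]
        field_simp
      calc T - T * Q * P = T * (1 - Q * P) := by rw [mul_sub, mul_one, mul_assoc]
        _ = T * (ε • Q) := by rw [h2, add_sub_cancel_left]
        _ = ε • (T * Q) := by rw [mul_smul_comm]
    rw [h1, norm_smul, Real.norm_of_nonneg hε.le]
    nlinarith
  · have h1 : star (T * Q) * T = cfc (fun x : ℝ => ((x + ε)⁻¹ * x) * x) P := by
      rw [cfc_mul (fun x : ℝ => (x + ε)⁻¹ * x) (fun x : ℝ => x) P (hg.mul (by fun_prop))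
        (by fun_prop), ← hQP, hPid, star_mul, hQsa, mul_assoc, hPP, mul_assoc]
    rw [h1, ← cfc_const ε P, ← cfc_add (a := P) (fun x : ℝ => ((x + ε)⁻¹ * x) * x)
      (fun _ : ℝ => ε) ((hg.mul (by fun_prop)).mul (by fun_prop)) (by fun_prop)]
    conv_lhs => rw [← hPid]
    refine cfc_mono (fun x hx => ?_) (by fun_prop)
      (((hg.mul (by fun_prop)).mul (by fun_prop)).add (by fun_prop))
    have hx0 := hsp x hx
    have hpos : 0 < x + ε := by positivity
    have : (x + ε)⁻¹ * x * x + ε - x = (x + ε)⁻¹ * ε ^ 2 := by field_simp; ring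
    have h5 : 0 ≤ (x + ε)⁻¹ * ε ^ 2 := by positivity
    linarith

theorem sum_re_inner_le_eTraceNorm (b : HilbertBasis ℕ ℂ 𝓗) (U A : 𝓗 →L[ℂ] 𝓗) (hU : ‖U‖ ≤ 1)
    (s : Finset ℕ) :
    ∑ n ∈ s, ENNReal.ofReal (RCLike.re ⟪U (b n), A (b n)⟫_ℂ) ≤ eTraceNorm b A := by
  have key : ∀ ε : ℝ, 0 < ε → ∑ n ∈ s, ENNReal.ofReal (RCLike.re ⟪U (b n), A (b n)⟫_ℂ) ≤
      eTraceNorm b A + s.card * ENNReal.ofReal ε := by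
    intro ε hε
    obtain ⟨V, hV, hV2, -⟩ := exists_approx_polar A hε
    set R := CFC.sqrt (CFC.abs A) with hR
    have hRsa : star R = R := (CFC.sqrt_nonneg (CFC.abs A)).isSelfAdjoint.star_eq
    have hRR : R * R = CFC.abs A := CFC.sqrt_mul_sqrt_self _ (CFC.abs_nonneg A)
    set W := star V * U with hW
    have hWn : ‖W‖ ≤ 1 := by
      refine (norm_mul_le _ _).trans ?_
      rw [norm_star]
      exact mul_le_one₀ hV (norm_nonneg _) hU
    have h1 : ∀ n, ENNReal.ofReal (RCLike.re ⟪U (b n), A (b n)⟫_ℂ) ≤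
        ENNReal.ofReal (1 / 2) * (ENNReal.ofReal (‖(R * W) (b n)‖ ^ 2) +
          ENNReal.ofReal (‖R (b n)‖ ^ 2)) + ENNReal.ofReal ε := by
      intro n
      rw [← ENNReal.ofReal_add (by positivity) (by positivity),
        ← ENNReal.ofReal_mul (by norm_num), ← ENNReal.ofReal_add (by positivity) hε.le]
      refine ENNReal.ofReal_le_ofReal ?_
      have hb : ‖b n‖ = 1 := b.orthonormal.1 n
      have e1 : ⟪U (b n), A (b n)⟫_ℂ = ⟪(R * W) (b n), R (b n)⟫_ℂ +
          ⟪U (b n), (A - V * CFC.abs A) (b n)⟫_ℂ := by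
        have e2 : ⟪(R * W) (b n), R (b n)⟫_ℂ = ⟪U (b n), (V * CFC.abs A) (b n)⟫_ℂ := by
          rw [mul_apply_eq_comp, ← ContinuousLinearMap.adjoint_inner_right,
            ← ContinuousLinearMap.star_eq_adjoint, hRsa, hW, mul_apply_eq_comp,
            ContinuousLinearMap.star_eq_adjoint, ContinuousLinearMap.adjoint_inner_left,
            ← hRR]
          rfl
        rw [e2, ← inner_add_right]
        congr 1
        simp
      have hUb : ‖U (b n)‖ ≤ 1 := (U.le_of_opNorm_le hU _).trans (by rw [hb, mul_one])
      have e3 : RCLike.re ⟪U (b n), (A - V * CFC.abs A) (b n)⟫_ℂ ≤ ε := by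
        refine (re_inner_le_norm _ _).trans ?_
        have h4 := (A - V * CFC.abs A).le_of_opNorm_le hV2 (b n)
        rw [hb, mul_one] at h4
        nlinarith [norm_nonneg (U (b n)), norm_nonneg ((A - V * CFC.abs A) (b n))]
      have e4 : RCLike.re ⟪(R * W) (b n), R (b n)⟫_ℂ ≤ ‖(R * W) (b n)‖ * ‖R (b n)‖ :=
        re_inner_le_norm _ _
      rw [e1, map_add]
      nlinarith [sq_nonneg (‖(R * W) (b n)‖ - ‖R (b n)‖)]
    calc ∑ n ∈ s, ENNReal.ofReal (RCLike.re ⟪U (b n), A (b n)⟫_ℂ)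
        ≤ ∑ n ∈ s, (ENNReal.ofReal (1 / 2) * (ENNReal.ofReal (‖(R * W) (b n)‖ ^ 2) +
          ENNReal.ofReal (‖R (b n)‖ ^ 2)) + ENNReal.ofReal ε) := Finset.sum_le_sum fun n _ => h1 n
      _ = ENNReal.ofReal (1 / 2) * (∑ n ∈ s, ENNReal.ofReal (‖(R * W) (b n)‖ ^ 2) +
          ∑ n ∈ s, ENNReal.ofReal (‖R (b n)‖ ^ 2)) + s.card * ENNReal.ofReal ε := by
          rw [Finset.sum_add_distrib, ← Finset.mul_sum, Finset.sum_add_distrib, Finset.sum_const,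
            nsmul_eq_mul]
      _ ≤ ENNReal.ofReal (1 / 2) * (eTraceNorm b A + eTraceNorm b A) +
          s.card * ENNReal.ofReal ε := by
          gcongr
          · refine (ENNReal.sum_le_tsum s).trans ?_
            rw [eTraceNorm_eq]
            exact eHilbertSchmidtSq_mul_right_le b R W hWn
          · refine (ENNReal.sum_le_tsum s).trans ?_
            rw [eTraceNorm_eq]
            rfl
      _ = eTraceNorm b A + s.card * ENNReal.ofReal ε := by
          rw [← two_mul, ← mul_assoc]
          have : ENNReal.ofReal (1 / 2) * 2 = 1 := by
            rw [← ENNReal.ofReal_ofNat, ← ENNReal.ofReal_mul (by norm_num)]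
            norm_num
          rw [this, one_mul]
  have hlim : Tendsto (fun ε : ℝ => eTraceNorm b A + s.card * ENNReal.ofReal ε) (𝓝[>] 0)
      (𝓝 (eTraceNorm b A + s.card * ENNReal.ofReal 0)) := by
    refine Tendsto.const_add _ (ENNReal.Tendsto.const_mul ?_ (Or.inr (by simp)))
    exact (ENNReal.continuous_ofReal.tendsto 0).mono_left nhdsWithin_le_nhds
  rw [ENNReal.ofReal_zero, mul_zero, add_zero] at hlim
  exact ge_of_tendsto hlim (eventually_nhdsWithin_of_forall key)

theorem eTraceNorm_add_le (b : HilbertBasis ℕ ℂ 𝓗) (A B : 𝓗 →L[ℂ] 𝓗) :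
    eTraceNorm b (A + B) ≤ eTraceNorm b A + eTraceNorm b B := by
  unfold eTraceNorm
  rw [ENNReal.tsum_eq_iSup_sum]
  refine iSup_le fun s => ?_
  change _ ≤ eTraceNorm b A + eTraceNorm b B
  have key : ∀ ε : ℝ, 0 < ε →
      ∑ n ∈ s, ENNReal.ofReal (RCLike.re ⟪b n, CFC.abs (A + B) (b n)⟫_ℂ) ≤
      eTraceNorm b A + eTraceNorm b B + s.card * ENNReal.ofReal ε := by
    intro ε hε
    obtain ⟨U, hU, -, hU2⟩ := exists_approx_polar (A + B) hε
    have h1 : ∀ n, ENNReal.ofReal (RCLike.re ⟪b n, CFC.abs (A + B) (b n)⟫_ℂ) ≤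
        ENNReal.ofReal (RCLike.re ⟪U (b n), A (b n)⟫_ℂ) +
        ENNReal.ofReal (RCLike.re ⟪U (b n), B (b n)⟫_ℂ) + ENNReal.ofReal ε := by
      intro n
      have hb : ‖b n‖ = 1 := b.orthonormal.1 n
      have h2 : RCLike.re ⟪b n, CFC.abs (A + B) (b n)⟫_ℂ ≤ RCLike.re ⟪U (b n), A (b n)⟫_ℂ +
          RCLike.re ⟪U (b n), B (b n)⟫_ℂ + ε := by
        have h3 := ((ContinuousLinearMap.le_def _ _).1 hU2).re_inner_nonneg_right (b n)
        have h4 : ⟪b n, (star U * (A + B)) (b n)⟫_ℂ = ⟪U (b n), A (b n)⟫_ℂ +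
            ⟪U (b n), B (b n)⟫_ℂ := by
          rw [mul_apply_eq_comp, ContinuousLinearMap.star_eq_adjoint,
            ContinuousLinearMap.adjoint_inner_right, add_apply,
            inner_add_right]
        have h5 : RCLike.re ⟪b n, (algebraMap ℝ (𝓗 →L[ℂ] 𝓗) ε) (b n)⟫_ℂ = ε := by
          rw [Algebra.algebraMap_eq_smul_one, smul_apply,
            one_apply_eq_self, re_inner_real_smul_right, inner_self_eq_norm_sq, hb]
          simp
        rw [sub_apply, add_apply, inner_sub_right,
          inner_add_right, h4, map_sub, map_add, map_add, h5] at h3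
        linarith
      refine (ENNReal.ofReal_le_ofReal h2).trans ?_
      exact ENNReal.ofReal_add_le.trans (add_le_add_left ENNReal.ofReal_add_le _)
    refine (Finset.sum_le_sum fun n _ => h1 n).trans ?_
    rw [Finset.sum_add_distrib, Finset.sum_add_distrib, Finset.sum_const, nsmul_eq_mul]
    gcongr
    · exact sum_re_inner_le_eTraceNorm b U A hU s
    · exact sum_re_inner_le_eTraceNorm b U B hU s
  have hlim : Tendsto (fun ε : ℝ => eTraceNorm b A + eTraceNorm b B + s.card * ENNReal.ofReal ε)
      (𝓝[>] 0) (𝓝 (eTraceNorm b A + eTraceNorm b B + s.card * ENNReal.ofReal 0)) := by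
    refine Tendsto.const_add _ (ENNReal.Tendsto.const_mul ?_ (Or.inr (by simp)))
    exact (ENNReal.continuous_ofReal.tendsto 0).mono_left nhdsWithin_le_nhds
  rw [ENNReal.ofReal_zero, mul_zero, add_zero] at hlim
  exact ge_of_tendsto hlim (eventually_nhdsWithin_of_forall key)

theorem eTraceNorm_smul (b : HilbertBasis ℕ ℂ 𝓗) (c : ℂ) (T : 𝓗 →L[ℂ] 𝓗) :
    eTraceNorm b (c • T) = ENNReal.ofReal ‖c‖ * eTraceNorm b T := by
  unfold eTraceNorm
  rw [← ENNReal.tsum_mul_left]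
  refine tsum_congr fun n => ?_
  rw [← ENNReal.ofReal_mul (norm_nonneg c), CFC.abs_smul]
  congr 1
  rw [smul_apply, re_inner_real_smul_right]

theorem eTraceNorm_zero (b : HilbertBasis ℕ ℂ 𝓗) : eTraceNorm b (0 : 𝓗 →L[ℂ] 𝓗) = 0 := by
  simp [eTraceNorm]

theorem eq_zero_of_eTraceNorm_eq_zero (b : HilbertBasis ℕ ℂ 𝓗) (T : 𝓗 →L[ℂ] 𝓗)
    (h : eTraceNorm b T = 0) : T = 0 := by
  rw [eTraceNorm_eq, eHilbertSchmidtSq, ENNReal.tsum_eq_zero] at h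
  have h1 : CFC.sqrt (CFC.abs T) = 0 := by
    refine ContinuousLinearMap.ext_on (s := Set.range b) ?_ ?_
    · have := b.dense_span
      rw [Submodule.dense_iff_topologicalClosure_eq_top]
      exact this
    · rintro _ ⟨n, rfl⟩
      have := h n
      rw [ENNReal.ofReal_eq_zero] at this
      have h2 : ‖CFC.sqrt (CFC.abs T) (b n)‖ = 0 := by
        nlinarith [norm_nonneg (CFC.sqrt (CFC.abs T) (b n))]
      simpa using h2
  have h2 : CFC.abs T = 0 := by
    rw [← CFC.sqrt_mul_sqrt_self _ (CFC.abs_nonneg T), h1, zero_mul]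
  exact CFC.abs_eq_zero_iff.1 h2

/-- The subspace of bounded operators with finite trace norm. -/
def traceClassSubmodule (b : HilbertBasis ℕ ℂ 𝓗) : Submodule ℂ (𝓗 →L[ℂ] 𝓗) where
  carrier := {T | eTraceNorm b T < ∞}
  add_mem' {A B} hA hB := (eTraceNorm_add_le b A B).trans_lt (ENNReal.add_lt_top.2 ⟨hA, hB⟩)
  zero_mem' := by
    rw [Set.mem_ofPred_eq, eTraceNorm_zero]
    exact ENNReal.zero_lt_top
  smul_mem' c T hT := by
    rw [Set.mem_ofPred_eq, eTraceNorm_smul]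
    exact ENNReal.mul_lt_top ENNReal.ofReal_lt_top hT

/-- The space `𝒯₁(𝓗)` of trace-class operators. It is a type of its own, because it carries the
trace norm and not the operator norm. -/
def TraceClass (b : HilbertBasis ℕ ℂ 𝓗) : Type _ := ↥(traceClassSubmodule b)

instance (b : HilbertBasis ℕ ℂ 𝓗) : AddCommGroup (TraceClass b) :=
  inferInstanceAs (AddCommGroup ↥(traceClassSubmodule b))

instance (b : HilbertBasis ℕ ℂ 𝓗) : Module ℂ (TraceClass b) :=
  inferInstanceAs (Module ℂ ↥(traceClassSubmodule b))

/-- The inclusion of the trace-class operators into the bounded operators. -/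
def TraceClass.toOp {b : HilbertBasis ℕ ℂ 𝓗} : TraceClass b →ₗ[ℂ] (𝓗 →L[ℂ] 𝓗) :=
  (traceClassSubmodule b).subtype

instance (b : HilbertBasis ℕ ℂ 𝓗) : Norm (TraceClass b) :=
  ⟨fun T => (eTraceNorm b T.toOp).toReal⟩

theorem TraceClass.core (b : HilbertBasis ℕ ℂ 𝓗) : NormedSpace.Core ℂ (TraceClass b) where
  norm_nonneg _ := ENNReal.toReal_nonneg
  norm_smul c T := by
    change (eTraceNorm b (TraceClass.toOp (c • T))).toReal = _ * (eTraceNorm b T.toOp).toReal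
    rw [map_smul, eTraceNorm_smul, ENNReal.toReal_mul, ENNReal.toReal_ofReal (norm_nonneg c)]
  norm_triangle A B := by
    change (eTraceNorm b (TraceClass.toOp (A + B))).toReal ≤
      (eTraceNorm b A.toOp).toReal + (eTraceNorm b B.toOp).toReal
    have hA : eTraceNorm b A.toOp ≠ ∞ := ne_of_lt A.2
    have hB : eTraceNorm b B.toOp ≠ ∞ := ne_of_lt B.2
    rw [map_add, ← ENNReal.toReal_add hA hB]
    exact ENNReal.toReal_mono (ENNReal.add_ne_top.2 ⟨hA, hB⟩) (eTraceNorm_add_le b _ _)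
  norm_eq_zero_iff T := by
    change (eTraceNorm b T.toOp).toReal = 0 ↔ T = 0
    constructor
    · intro h
      have hT : eTraceNorm b T.toOp ≠ ∞ := ne_of_lt T.2
      rw [ENNReal.toReal_eq_zero_iff, or_iff_left hT] at h
      exact Subtype.ext (eq_zero_of_eTraceNorm_eq_zero b _ h)
    · rintro rfl
      rw [map_zero, eTraceNorm_zero, ENNReal.toReal_zero]

instance (b : HilbertBasis ℕ ℂ 𝓗) : NormedAddCommGroup (TraceClass b) :=
  NormedAddCommGroup.ofCore (TraceClass.core b)

instance (b : HilbertBasis ℕ ℂ 𝓗) : NormedSpace ℂ (TraceClass b) :=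
  NormedSpace.ofCore (TraceClass.core b)

end TraceClassOperators

/-! ### Unbounded operators, their spectra, and strongly continuous semigroups -/

noncomputable section Semigroups

/-- The resolvent set of an unbounded operator `A`: those `z` for which `A - z` has a bounded
inverse `B : E → D(A)`, that is `(A - z) B = 1` and `B (A - z) = 1` on `D(A)`. -/
def unboundedResolventSet {E : Type*} [NormedAddCommGroup E] [NormedSpace ℂ E]
    (A : E →ₗ.[ℂ] E) : Set ℂ :=
  {z | ∃ B : E →L[ℂ] E,
    (∀ x : E, ∃ h : B x ∈ A.domain, A ⟨B x, h⟩ - z • B x = x) ∧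
    (∀ x : A.domain, B (A x - z • (x : E)) = x)}

/-- The spectrum of an unbounded operator, the complement of the resolvent set. -/
def unboundedSpectrum {E : Type*} [NormedAddCommGroup E] [NormedSpace ℂ E]
    (A : E →ₗ.[ℂ] E) : Set ℂ :=
  (unboundedResolventSet A)ᶜ

/-- `A` has a spectral gap: for some `c < 0`, every `z ∈ Sp(A) ∖ {0}` has `Re z ≤ c`. -/
def HasSpectralGap {E : Type*} [NormedAddCommGroup E] [NormedSpace ℂ E]
    (A : E →ₗ.[ℂ] E) : Prop :=
  ∃ c : ℝ, c < 0 ∧ ∀ z ∈ unboundedSpectrum A \ {0}, z.re ≤ c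

/-- A strongly continuous one-parameter semigroup of bounded operators. -/
structure C0Semigroup (E : Type*) [NormedAddCommGroup E] [NormedSpace ℂ E] where
  /-- the operator at time `t ≥ 0` -/
  op : ℝ≥0 → E →L[ℂ] E
  op_zero : op 0 = ContinuousLinearMap.id ℂ E
  op_add : ∀ s t, op (s + t) = (op s).comp (op t)
  continuous_orbit : ∀ x, Continuous fun t => op t x

namespace C0Semigroup

variable {E : Type*} [NormedAddCommGroup E] [NormedSpace ℂ E]

/-- `y` is the right derivative at `t = 0` of the orbit `t ↦ Φₜ x`. -/
def HasDerivAtZero (Φ : C0Semigroup E) (x y : E) : Prop :=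
  Tendsto (fun t : ℝ≥0 => ((t : ℝ) : ℂ)⁻¹ • (Φ.op t x - x)) (𝓝[≠] 0) (𝓝 y)

theorem HasDerivAtZero.unique {Φ : C0Semigroup E} {x y z : E} (hy : Φ.HasDerivAtZero x y)
    (hz : Φ.HasDerivAtZero x z) : y = z :=
  tendsto_nhds_unique hy hz

theorem HasDerivAtZero.add {Φ : C0Semigroup E} {x x' y y' : E} (h : Φ.HasDerivAtZero x y)
    (h' : Φ.HasDerivAtZero x' y') : Φ.HasDerivAtZero (x + x') (y + y') := by
  refine (Tendsto.add h h').congr fun t => ?_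
  rw [map_add, ← smul_add]
  congr 1
  abel

theorem HasDerivAtZero.smul {Φ : C0Semigroup E} {x y : E} (c : ℂ) (h : Φ.HasDerivAtZero x y) :
    Φ.HasDerivAtZero (c • x) (c • y) := by
  refine (Tendsto.const_smul h c).congr fun t => ?_
  rw [map_smul, ← smul_sub, smul_comm]

/-- The generator of a strongly continuous semigroup: its domain consists of those `x` for which
`(Φₜ x - x) / t` converges as `t ↓ 0`, and its value at `x` is the limit. -/
def generator (Φ : C0Semigroup E) : E →ₗ.[ℂ] E where
  domain :=
    { carrier := {x | ∃ y, Φ.HasDerivAtZero x y}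
      add_mem' := fun ⟨y, hy⟩ ⟨y', hy'⟩ => ⟨y + y', hy.add hy'⟩
      zero_mem' := ⟨0, by simp [HasDerivAtZero]⟩
      smul_mem' := fun c _ ⟨y, hy⟩ => ⟨c • y, hy.smul c⟩ }
  toFun :=
    { toFun := fun x => Classical.choose x.2
      map_add' := fun x x' => HasDerivAtZero.unique (Classical.choose_spec (x + x').2)
        ((Classical.choose_spec x.2).add (Classical.choose_spec x'.2))
      map_smul' := fun c x => HasDerivAtZero.unique (Classical.choose_spec (c • x).2)
        ((Classical.choose_spec x.2).smul c) }

end C0Semigroup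

end Semigroups

/-! ### The Gibbs sampler generator for the number operator with jumps `a`, `a†` -/

noncomputable section GibbsGenerator

/-- The conditions on the filter function `f̂` at inverse temperature `β`. -/
structure IsKMSFilter (β : ℝ) (f : ℝ → ℂ) : Prop where
  symm : ∀ ν : ℝ, conj (f ν) = f (-ν) * (Real.exp (-(β * ν / 2)) : ℂ)
  bounded : ∃ C : ℝ, ∀ ν : ℝ, ‖f ν‖ ≤ C ∧ Real.exp (β * ν / 2) * ‖f ν‖ ≤ C

/-- The annihilation operator `a |n⟩ = √n |n-1⟩` on the finite linear combinations of Fock states;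
`Finsupp.single n 1` stands for `|n⟩`. -/
def annihilation : (ℕ →₀ ℂ) →ₗ[ℂ] (ℕ →₀ ℂ) :=
  Finsupp.linearCombination ℂ fun n => Finsupp.single (n - 1) (Real.sqrt n : ℂ)

/-- The creation operator `a† |n⟩ = √(n+1) |n+1⟩`. -/
def creation : (ℕ →₀ ℂ) →ₗ[ℂ] (ℕ →₀ ℂ) :=
  Finsupp.linearCombination ℂ fun n => Finsupp.single (n + 1) (Real.sqrt (n + 1) : ℂ)

/-- `L |i⟩ = ∑_k f̂(k - i) P_k A |i⟩`, the filtered jump at the `i`-th eigenstate of `N`, where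
`P_k = |k⟩⟨k|` is the eigenprojection of `N` for the eigenvalue `k`. -/
def filteredJump (f : ℝ → ℂ) (A : (ℕ →₀ ℂ) →ₗ[ℂ] (ℕ →₀ ℂ)) (i : ℕ) : ℕ →₀ ℂ :=
  (A (Finsupp.single i 1)).sum fun k c => Finsupp.single k (f ((k : ℝ) - i) * c)

/-- The contribution
`- ∑_{k,l} conj f̂(k - l) f̂(k - i) e^{β(i-l)/4} / (2 cosh(β(i-l)/4)) P_l A† P_k A |i⟩`
of one jump `A`, with adjoint `Aadj`, to the drift `G |i⟩`. -/
def driftTerm (β : ℝ) (f : ℝ → ℂ) (A Aadj : (ℕ →₀ ℂ) →ₗ[ℂ] (ℕ →₀ ℂ)) (i : ℕ) : ℕ →₀ ℂ :=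
  -(A (Finsupp.single i 1)).sum fun k c => (Aadj (Finsupp.single k c)).sum fun l d =>
    Finsupp.single l (conj (f ((k : ℝ) - l)) * f ((k : ℝ) - i) *
      ((Real.exp (β * ((i : ℝ) - l) / 4) / (2 * Real.cosh (β * ((i : ℝ) - l) / 4)) : ℝ) : ℂ) * d)

/-- The drift `G |i⟩` for the jumps `a` and `a†`. -/
def drift (β : ℝ) (f : ℝ → ℂ) (i : ℕ) : ℕ →₀ ℂ :=
  driftTerm β f annihilation creation i + driftTerm β f creation annihilation i

variable {𝓗 : Type*} [NormedAddCommGroup 𝓗] [InnerProductSpace ℂ 𝓗] [CompleteSpace 𝓗]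

/-- The vector of `𝓗` with the given finitely many coordinates in the Fock basis. -/
def fockVector (b : HilbertBasis ℕ ℂ 𝓗) (v : ℕ →₀ ℂ) : 𝓗 :=
  Finsupp.linearCombination ℂ (fun n => b n) v

/-- The value on `|i⟩⟨j|` of the Gibbs sampler generator with `H = N` and jumps `a`, `a†`:
`∑_α L^α |i⟩ (L^α |j⟩)† + G |i⟩⟨j| + |i⟩ (G |j⟩)†`. -/
def gibbsLindbladian (b : HilbertBasis ℕ ℂ 𝓗) (β : ℝ) (f : ℝ → ℂ) (i j : ℕ) : 𝓗 →L[ℂ] 𝓗 :=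
  InnerProductSpace.rankOne ℂ (fockVector b (filteredJump f annihilation i))
      (fockVector b (filteredJump f annihilation j)) +
    InnerProductSpace.rankOne ℂ (fockVector b (filteredJump f creation i))
      (fockVector b (filteredJump f creation j)) +
    InnerProductSpace.rankOne ℂ (fockVector b (drift β f i)) (b j) +
    InnerProductSpace.rankOne ℂ (b i) (fockVector b (drift β f j))

/-- `Φ` is a quantum Ornstein-Uhlenbeck semigroup: a strongly continuous semigroup on the
trace-class operators whose generator is defined on all `|i⟩⟨j|` and is given there by the Gibbs
sampler expression. -/
def IsQuantumOUSemigroup (b : HilbertBasis ℕ ℂ 𝓗) (β : ℝ) (f : ℝ → ℂ)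
    (Φ : C0Semigroup (TraceClass b)) : Prop :=
  ∀ i j : ℕ, ∃ x : Φ.generator.domain,
    (x : TraceClass b).toOp = InnerProductSpace.rankOne ℂ (b i) (b j) ∧
    (Φ.generator x).toOp = gibbsLindbladian b β f i j

end GibbsGenerator

/-!
Write `p = |f̂(1)|²` and `q = |f̂(-1)|²`; the symmetry of `f̂` gives `0 < p < q`. On the span `D` of
the matrix units `|i⟩⟨j|` the generator is
`L ρ = p (a† ρ a - ½ {a a†, ρ}) + q (a ρ a† - ½ {a† a, ρ})`.

*Generation.* The semigroup comes from the Lumer-Phillips theorem, proved here with Yosida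
approximations, so three things are needed for `L` on the Banach space of trace-class operators.
`D` is dense, because a trace-class operator with polar decomposition `T = U |T|` is the product of
the Hilbert-Schmidt operators `U |T|^{1/2}` and `|T|^{1/2}` (`TraceClass.denseRange_ofFinsupp`).
`L` is dissipative: for `x = U P` with `P = |x|`, the real part of `Tr (U† (V x V† - ½ {V† V, x}))`
is at most zero, because `Re ⟨U V P^{1/2}, V U P^{1/2}⟩` is bounded by the mean of
`‖V P^{1/2}‖²` and `‖V U P^{1/2}‖²` in the Hilbert-Schmidt norm
(`re_levelTrace_dissipator_nonpos`). Finally `z - L` has dense range for `Re z > 0`: a functional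
that vanishes on the range takes bounded values on the `|i⟩⟨j|`, which satisfy a three-term
recursion along each diagonal, and nonzero solutions of it grow like `∏ (1 + Re z / cₖ)` with `cₖ`
of linear growth (`eq_zero_of_three_term_recursion`).

*Uniqueness.* On the range of the squared resolvent, two semigroups whose generators extend `L` have
the same first-order expansion with a quadratic error; telescoping shows that they agree
(`IsMDissipativeCore.eq_semigroup`).

*Spectrum.* The open right half-plane lies in the resolvent set by construction. For `Re z < 0` the
diagonal operator `∑ xₙ |n⟩⟨n|`, where `∑ xₙ sⁿ = (1 - s)ʷ (1 - (p / q) s)^(-w-1)` and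
`w = -z / (q - p)`, is a trace-class eigenvector: `Re w > 0` makes the coefficients absolutely
summable (`exists_summable_eigenvector`, `exists_eigenvector_mem_closure`). If `Re z ≤ 0` and `B`
were a bounded inverse of `A - z`, an eigenvector `T` for `z - ε` would satisfy `T = -ε B T`, which
is impossible for small `ε`.
-/

/-! ### Trace-class operators: polar decomposition, completeness, density -/

noncomputable section TraceClassTheory

set_option linter.unusedSectionVars false

variable {𝓗 : Type*} [NormedAddCommGroup 𝓗] [InnerProductSpace ℂ 𝓗] [CompleteSpace 𝓗]

theorem norm_abs_apply (T : 𝓗 →L[ℂ] 𝓗) (x : 𝓗) : ‖CFC.abs T x‖ = ‖T x‖ := by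
  have hsa : star (CFC.abs T) = CFC.abs T := (CFC.abs_nonneg T).isSelfAdjoint.star_eq
  have h : ∀ S : 𝓗 →L[ℂ] 𝓗, ⟪S x, S x⟫_ℂ = ⟪x, (star S * S) x⟫_ℂ := fun S => by
    rw [mul_apply_eq_comp, ContinuousLinearMap.star_eq_adjoint,
      ContinuousLinearMap.adjoint_inner_right]
  have h1 : ⟪CFC.abs T x, CFC.abs T x⟫_ℂ = ⟪T x, T x⟫_ℂ := by
    rw [h, h, hsa, CFC.abs_mul_abs]
  have h2 : ‖CFC.abs T x‖ ^ 2 = ‖T x‖ ^ 2 := by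
    rw [← inner_self_eq_norm_sq (𝕜 := ℂ), ← inner_self_eq_norm_sq (𝕜 := ℂ), h1]
  exact (sq_eq_sq₀ (norm_nonneg _) (norm_nonneg _)).1 h2

/-- Polar decomposition: `T = U |T|` and `|T| = U† T` for some contraction `U`. -/
theorem exists_polar (T : 𝓗 →L[ℂ] 𝓗) :
    ∃ U : 𝓗 →L[ℂ] 𝓗, ‖U‖ ≤ 1 ∧ U * CFC.abs T = T ∧ star U * T = CFC.abs T := by
  set P := CFC.abs T with hP
  let K : Submodule ℂ 𝓗 := (LinearMap.range P.toLinearMap).topologicalClosure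
  have hK : ∀ x, P x ∈ K := fun x => Submodule.le_topologicalClosure _ ⟨x, rfl⟩
  let e : 𝓗 →ₗ[ℂ] K := P.toLinearMap.codRestrict K hK
  have he : DenseRange e := by
    intro y
    rw [mem_closure_iff_seq_limit]
    obtain ⟨u, hu, hlim⟩ := mem_closure_iff_seq_limit.1
      (show (y : 𝓗) ∈ closure (LinearMap.range P.toLinearMap : Set 𝓗) from y.2)
    choose v hv using hu
    refine ⟨fun n => e (v n), fun n => ⟨v n, rfl⟩, ?_⟩
    rw [tendsto_subtype_rng]
    refine hlim.congr fun n => ?_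
    exact (hv n).symm
  have hn : ∀ x, ‖T.toLinearMap x‖ ≤ 1 * ‖e x‖ := fun x => by
    rw [one_mul]
    exact (norm_abs_apply T x).ge
  let W : K →L[ℂ] 𝓗 := LinearMap.extendOfNorm T.toLinearMap e
  have hKc : IsClosed (K : Set 𝓗) := Submodule.isClosed_topologicalClosure _
  have : CompleteSpace K := hKc.completeSpace_coe
  let U : 𝓗 →L[ℂ] 𝓗 := W.comp K.orthogonalProjectionOnto
  have hU : ‖U‖ ≤ 1 := by
    refine (ContinuousLinearMap.opNorm_comp_le _ _).trans ?_
    exact mul_le_one₀ (LinearMap.opNorm_extendOfNorm_le he zero_le_one hn) (norm_nonneg _)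
      (Submodule.orthogonalProjectionOnto_norm_le K)
  have hUP : ∀ x, U (P x) = T x := fun x => by
    have h1 : K.orthogonalProjectionOnto (P x) = e x :=
      Submodule.orthogonalProjectionOnto_mem_subspace_eq_self (K := K) (e x)
    change W (K.orthogonalProjectionOnto (P x)) = T x
    rw [h1]
    exact LinearMap.extendOfNorm_eq he ⟨1, hn⟩ x
  refine ⟨U, hU, ContinuousLinearMap.ext hUP, ContinuousLinearMap.ext fun x => ?_⟩
  -- `U` is isometric on the range of `|T|`, so equality holds in the Cauchy-Schwarz inequality.
  have h1 : ‖star U (T x) - P x‖ ^ 2 ≤ 0 := by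
    rw [@norm_sub_sq ℂ, ContinuousLinearMap.star_eq_adjoint,
      ContinuousLinearMap.adjoint_inner_left, hUP, inner_self_eq_norm_sq, norm_abs_apply]
    have h2 : ‖ContinuousLinearMap.adjoint U (T x)‖ ≤ ‖T x‖ := by
      refine (ContinuousLinearMap.le_of_opNorm_le _ (c := 1) ?_ _).trans (by rw [one_mul])
      rwa [LinearIsometryEquiv.norm_map]
    nlinarith [norm_nonneg (ContinuousLinearMap.adjoint U (T x)), norm_nonneg (T x)]
  have h2 : ‖star U (T x) - P x‖ = 0 := by nlinarith [norm_nonneg (star U (T x) - P x)]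
  exact sub_eq_zero.1 (norm_eq_zero.1 h2)

theorem norm_sq_apply_le_eHilbertSchmidtSq (b : HilbertBasis ℕ ℂ 𝓗) (S : 𝓗 →L[ℂ] 𝓗) (x : 𝓗) :
    ENNReal.ofReal (‖S x‖ ^ 2) ≤ eHilbertSchmidtSq b S * ENNReal.ofReal (‖x‖ ^ 2) := by
  rw [← eHilbertSchmidtSq_adjoint, eHilbertSchmidtSq, ofReal_normSq_eq_tsum b,
    ← ENNReal.tsum_mul_right]
  refine ENNReal.tsum_le_tsum fun n => ?_
  rw [← ENNReal.ofReal_mul (by positivity)]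
  refine ENNReal.ofReal_le_ofReal ?_
  rw [← mul_pow, ← ContinuousLinearMap.adjoint_inner_left, ContinuousLinearMap.star_eq_adjoint]
  exact pow_le_pow_left₀ (norm_nonneg _) (norm_inner_le_norm _ _) 2

theorem ofReal_norm_le_eTraceNorm (b : HilbertBasis ℕ ℂ 𝓗) (T : 𝓗 →L[ℂ] 𝓗) :
    ENNReal.ofReal ‖T‖ ≤ eTraceNorm b T := by
  by_cases htop : eTraceNorm b T = ∞
  · rw [htop]; exact le_top
  refine ENNReal.ofReal_le_of_le_toReal ?_
  set C := (eTraceNorm b T).toReal with hC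
  have hC0 : 0 ≤ C := ENNReal.toReal_nonneg
  have hCe : eTraceNorm b T = ENNReal.ofReal C := (ENNReal.ofReal_toReal htop).symm
  set R := CFC.sqrt (CFC.abs T) with hR
  have hRR : R * R = CFC.abs T := CFC.sqrt_mul_sqrt_self _ (CFC.abs_nonneg T)
  have h1 : ∀ x, ‖R x‖ ^ 2 ≤ C * ‖x‖ ^ 2 := fun x => by
    have := norm_sq_apply_le_eHilbertSchmidtSq b R x
    rwa [← eTraceNorm_eq, hCe, ← ENNReal.ofReal_mul hC0,
      ENNReal.ofReal_le_ofReal_iff (by positivity)] at this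
  refine T.opNorm_le_bound hC0 fun x => ?_
  have h2 : ‖T x‖ ^ 2 ≤ (C * ‖x‖) ^ 2 := by
    rw [← norm_abs_apply, ← hRR, mul_apply_eq_comp]
    nlinarith [h1 (R x), h1 x]
  exact (pow_le_pow_iff_left₀ (norm_nonneg _) (by positivity) two_ne_zero).1 h2

/-- The trace norm is lower semicontinuous for the operator norm. -/
theorem eTraceNorm_le_of_tendsto (b : HilbertBasis ℕ ℂ 𝓗) {X : ℕ → 𝓗 →L[ℂ] 𝓗} {T : 𝓗 →L[ℂ] 𝓗}
    {C : ℝ≥0∞} (hX : Tendsto X atTop (𝓝 T)) (hC : ∀ᶠ m in atTop, eTraceNorm b (X m) ≤ C) :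
    eTraceNorm b T ≤ C := by
  obtain ⟨U, hU, -, hU2⟩ := exists_polar T
  rw [eTraceNorm, ENNReal.tsum_eq_iSup_sum]
  refine iSup_le fun s => ?_
  have hlim : Tendsto (fun m => ∑ n ∈ s, ENNReal.ofReal (RCLike.re ⟪U (b n), X m (b n)⟫_ℂ)) atTop
      (𝓝 (∑ n ∈ s, ENNReal.ofReal (RCLike.re ⟪U (b n), T (b n)⟫_ℂ))) := by
    refine tendsto_finsetSum _ fun n _ => ENNReal.tendsto_ofReal ?_
    have h1 : Tendsto (fun m => X m (b n)) atTop (𝓝 (T (b n))) :=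
      ((ContinuousLinearMap.apply ℂ 𝓗 (b n)).continuous.tendsto T).comp hX
    exact (RCLike.continuous_re.tendsto _).comp (Tendsto.inner tendsto_const_nhds h1)
  have he : ∀ n, ⟪b n, CFC.abs T (b n)⟫_ℂ = ⟪U (b n), T (b n)⟫_ℂ := fun n => by
    rw [← hU2, mul_apply_eq_comp, ContinuousLinearMap.star_eq_adjoint,
      ContinuousLinearMap.adjoint_inner_right]
  simp_rw [he]
  refine le_of_tendsto hlim (hC.mono fun m hm => ?_)
  exact (sum_re_inner_le_eTraceNorm b U (X m) hU s).trans hm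

theorem TraceClass.norm_def {b : HilbertBasis ℕ ℂ 𝓗} (T : TraceClass b) :
    ‖T‖ = (eTraceNorm b T.toOp).toReal := rfl

theorem TraceClass.ofReal_norm {b : HilbertBasis ℕ ℂ 𝓗} (T : TraceClass b) :
    ENNReal.ofReal ‖T‖ = eTraceNorm b T.toOp :=
  ENNReal.ofReal_toReal (ne_of_lt T.2)

theorem TraceClass.norm_toOp_le {b : HilbertBasis ℕ ℂ 𝓗} (T : TraceClass b) :
    ‖T.toOp‖ ≤ ‖T‖ := by
  have := ofReal_norm_le_eTraceNorm b T.toOp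
  rwa [← TraceClass.ofReal_norm, ENNReal.ofReal_le_ofReal_iff (norm_nonneg _)] at this

theorem TraceClass.toOp_injective {b : HilbertBasis ℕ ℂ 𝓗} :
    Function.Injective (TraceClass.toOp (b := b)) := Subtype.val_injective

theorem TraceClass.norm_le_of_eTraceNorm_le {b : HilbertBasis ℕ ℂ 𝓗} {T : TraceClass b} {C : ℝ}
    (hC : 0 ≤ C) (h : eTraceNorm b T.toOp ≤ ENNReal.ofReal C) : ‖T‖ ≤ C := by
  rw [← TraceClass.ofReal_norm] at h
  exact (ENNReal.ofReal_le_ofReal_iff hC).1 h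

/-- An operator of finite trace norm, as an element of the trace class. -/
def TraceClass.mk (b : HilbertBasis ℕ ℂ 𝓗) (T : 𝓗 →L[ℂ] 𝓗) (hT : eTraceNorm b T < ∞) :
    TraceClass b := (⟨T, hT⟩ : traceClassSubmodule b)

theorem TraceClass.toOp_mk (b : HilbertBasis ℕ ℂ 𝓗) (T : 𝓗 →L[ℂ] 𝓗) (hT : eTraceNorm b T < ∞) :
    (TraceClass.mk b T hT).toOp = T := rfl

instance TraceClass.completeSpace (b : HilbertBasis ℕ ℂ 𝓗) : CompleteSpace (TraceClass b) := by
  refine Metric.complete_of_cauchySeq_tendsto fun u hu => ?_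
  have hop : CauchySeq fun n => (u n).toOp := by
    rw [Metric.cauchySeq_iff] at hu ⊢
    intro ε hε
    obtain ⟨N, hN⟩ := hu ε hε
    refine ⟨N, fun m hm n hn => ?_⟩
    refine lt_of_le_of_lt ?_ (hN m hm n hn)
    rw [dist_eq_norm, dist_eq_norm, ← map_sub]
    exact TraceClass.norm_toOp_le _
  obtain ⟨T, hT⟩ := cauchySeq_tendsto_of_complete hop
  have key : ∀ ε > 0, ∃ N, ∀ n ≥ N, eTraceNorm b (T - (u n).toOp) ≤ ENNReal.ofReal ε := by
    intro ε hε
    obtain ⟨N, hN⟩ := Metric.cauchySeq_iff.1 hu ε hε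
    refine ⟨N, fun n hn => eTraceNorm_le_of_tendsto b (hT.sub_const _)
      (eventually_atTop.2 ⟨N, fun m hm => ?_⟩)⟩
    rw [← map_sub, ← TraceClass.ofReal_norm, ← dist_eq_norm]
    exact ENNReal.ofReal_le_ofReal (hN m hm n hn).le
  obtain ⟨N, hN⟩ := key 1 one_pos
  have hmem : eTraceNorm b T < ∞ := by
    have h1 := eTraceNorm_add_le b (T - (u N).toOp) (u N).toOp
    rw [sub_add_cancel] at h1
    exact h1.trans_lt (ENNReal.add_lt_top.2 ⟨(hN N le_rfl).trans_lt ENNReal.ofReal_lt_top, (u N).2⟩)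
  refine ⟨TraceClass.mk b T hmem, ?_⟩
  rw [Metric.tendsto_atTop]
  intro ε hε
  obtain ⟨M, hM⟩ := key (ε / 2) (half_pos hε)
  refine ⟨M, fun n hn => ?_⟩
  rw [dist_comm, dist_eq_norm]
  refine lt_of_le_of_lt (TraceClass.norm_le_of_eTraceNorm_le (half_pos hε).le ?_) (half_lt_self hε)
  rw [map_sub, TraceClass.toOp_mk]
  exact hM n hn

/-- Hölder's inequality `‖A B‖₁ ≤ ‖A‖₂ ‖B‖₂`, in a form with a free parameter in place of the
square roots. -/
theorem eTraceNorm_mul_le (b : HilbertBasis ℕ ℂ 𝓗) (A B : 𝓗 →L[ℂ] 𝓗) {c : ℝ} (hc : 0 < c) :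
    eTraceNorm b (A * B) ≤ ENNReal.ofReal c * eHilbertSchmidtSq b A +
      ENNReal.ofReal c⁻¹ * eHilbertSchmidtSq b B := by
  obtain ⟨U, hU, -, hU2⟩ := exists_polar (A * B)
  refine le_trans ?_ (add_le_add_left (mul_le_mul_right
    ((eHilbertSchmidtSq_mul_right_le b (star A) U hU).trans
      (eHilbertSchmidtSq_adjoint b A).le) _) _)
  unfold eTraceNorm eHilbertSchmidtSq
  rw [← ENNReal.tsum_mul_left, ← ENNReal.tsum_mul_left, ← ENNReal.tsum_add]
  refine ENNReal.tsum_le_tsum fun n => ?_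
  rw [← ENNReal.ofReal_mul hc.le, ← ENNReal.ofReal_mul (by positivity),
    ← ENNReal.ofReal_add (by positivity) (by positivity)]
  refine ENNReal.ofReal_le_ofReal ?_
  have e : ⟪b n, CFC.abs (A * B) (b n)⟫_ℂ = ⟪(star A * U) (b n), B (b n)⟫_ℂ := by
    rw [← hU2, mul_apply_eq_comp, ContinuousLinearMap.star_eq_adjoint,
      ContinuousLinearMap.adjoint_inner_right, mul_apply_eq_comp, mul_apply_eq_comp,
      ContinuousLinearMap.star_eq_adjoint, ContinuousLinearMap.adjoint_inner_left]
  rw [e]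
  refine (re_inner_le_norm _ _).trans ?_
  have h1 : c * c⁻¹ = 1 := mul_inv_cancel₀ hc.ne'
  have h2 : 0 < c⁻¹ := inv_pos.2 hc
  set x := ‖(star A * U) (b n)‖
  set y := ‖B (b n)‖
  have hx : 0 ≤ x := norm_nonneg _
  have hy : 0 ≤ y := norm_nonneg _
  have h3 : x * y = (c * x) * (c⁻¹ * y) := by
    calc x * y = (c * c⁻¹) * (x * y) := by rw [h1, one_mul]
      _ = _ := by ring
  have h4 : c * x ^ 2 + c⁻¹ * y ^ 2 - 2 * (x * y) = c * (x - c⁻¹ * y) ^ 2 := by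
    have : c * (x - c⁻¹ * y) ^ 2 =
        c * x ^ 2 - 2 * (c * c⁻¹) * (x * y) + (c * c⁻¹) * c⁻¹ * y ^ 2 := by
      ring
    rw [this, h1]; ring
  nlinarith [mul_nonneg hc.le (sq_nonneg (x - c⁻¹ * y)), mul_nonneg hx hy]

/-- The orthogonal projection onto the span of the first `M` basis vectors. -/
def levelProj (b : HilbertBasis ℕ ℂ 𝓗) (M : ℕ) : 𝓗 →L[ℂ] 𝓗 :=
  ∑ n ∈ Finset.range M, InnerProductSpace.rankOne ℂ (b n) (b n)

theorem levelProj_apply_basis (b : HilbertBasis ℕ ℂ 𝓗) (M n : ℕ) :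
    levelProj b M (b n) = if n < M then b n else 0 := by
  have h := orthonormal_iff_ite.1 b.orthonormal
  simp [levelProj, sum_apply, h, ite_smul, Finset.sum_ite_eq']

theorem star_rankOne (x y : 𝓗) :
    star (InnerProductSpace.rankOne ℂ x y) = InnerProductSpace.rankOne ℂ y x := by
  rw [ContinuousLinearMap.star_eq_adjoint, InnerProductSpace.adjoint_rankOne]

theorem star_levelProj (b : HilbertBasis ℕ ℂ 𝓗) (M : ℕ) : star (levelProj b M) = levelProj b M := by
  simp [levelProj, star_sum, star_rankOne]

theorem ext_basis (b : HilbertBasis ℕ ℂ 𝓗) {S T : 𝓗 →L[ℂ] 𝓗} (h : ∀ n, S (b n) = T (b n)) :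
    S = T := by
  refine ContinuousLinearMap.ext_on (s := Set.range b) ?_ ?_
  · rw [Submodule.dense_iff_topologicalClosure_eq_top]
    exact b.dense_span
  · rintro _ ⟨n, rfl⟩
    exact h n

theorem levelProj_mul_self (b : HilbertBasis ℕ ℂ 𝓗) (M : ℕ) :
    levelProj b M * levelProj b M = levelProj b M := by
  refine ext_basis b fun n => ?_
  rw [mul_apply_eq_comp, levelProj_apply_basis]
  split_ifs with h
  · rw [levelProj_apply_basis, if_pos h]
  · rw [map_zero]

theorem tendsto_eHilbertSchmidtSq_mul_compl (b : HilbertBasis ℕ ℂ 𝓗) (S : 𝓗 →L[ℂ] 𝓗)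
    (hS : eHilbertSchmidtSq b S ≠ ∞) :
    Tendsto (fun M => eHilbertSchmidtSq b (S * (1 - levelProj b M))) atTop (𝓝 0) := by
  have h : Tendsto (fun M => ∑' n, ENNReal.ofReal (‖S (b (n + M))‖ ^ 2)) atTop (𝓝 0) :=
    ENNReal.tendsto_sum_nat_add (fun n => ENNReal.ofReal (‖S (b n)‖ ^ 2)) hS
  have e : ∀ M n, (S * (1 - levelProj b M)) (b n) = if n < M then 0 else S (b n) := fun M n => by
    rw [mul_apply_eq_comp, sub_apply, one_apply_eq_self, levelProj_apply_basis]
    split_ifs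
    · rw [sub_self, map_zero]
    · rw [sub_zero]
  have e2 : ∀ M, eHilbertSchmidtSq b (S * (1 - levelProj b M)) =
      ∑' n, ENNReal.ofReal (‖S (b (n + M))‖ ^ 2) := fun M => by
    have hinj : Function.Injective fun n : ℕ => n + M := add_left_injective M
    rw [eHilbertSchmidtSq, ← hinj.tsum_eq]
    · exact tsum_congr fun n => by rw [e, if_neg (Nat.not_lt.2 (Nat.le_add_left M n))]
    · intro n hn
      by_contra h1
      have h2 : n < M := by
        by_contra h3
        exact h1 ⟨n - M, Nat.sub_add_cancel (Nat.not_lt.1 h3)⟩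
      refine hn ?_
      dsimp only
      rw [e, if_pos h2, norm_zero, zero_pow two_ne_zero, ENNReal.ofReal_zero]
  simp_rw [e2]
  exact h

theorem ENNReal.tendsto_zero_of_le_mul_add_inv_mul {g : ℕ → ℝ≥0∞} {K : ℝ≥0∞} (hK : K ≠ ∞)
    (hg : Tendsto g atTop (𝓝 0)) {τ : ℕ → ℝ≥0∞}
    (h : ∀ c : ℝ, 0 < c → ∀ M, τ M ≤ ENNReal.ofReal c * K + ENNReal.ofReal c⁻¹ * g M) :
    Tendsto τ atTop (𝓝 0) := by
  rw [ENNReal.tendsto_nhds_zero]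
  intro ε hε
  obtain ⟨c, hc, hcK⟩ : ∃ c : ℝ, 0 < c ∧ ENNReal.ofReal c * K ≤ ε / 2 := by
    have h1 : Tendsto (fun c : ℝ => ENNReal.ofReal c * K) (𝓝[>] 0) (𝓝 (ENNReal.ofReal 0 * K)) :=
      ENNReal.Tendsto.mul_const
        ((ENNReal.continuous_ofReal.tendsto 0).mono_left nhdsWithin_le_nhds) (Or.inr hK)
    rw [ENNReal.ofReal_zero, zero_mul, ENNReal.tendsto_nhds_zero] at h1
    obtain ⟨c, h2, h3⟩ := ((h1 (ε / 2) (ENNReal.half_pos hε.ne')).and self_mem_nhdsWithin).exists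
    exact ⟨c, h3, h2⟩
  have h2 : Tendsto (fun M => ENNReal.ofReal c⁻¹ * g M) atTop (𝓝 (ENNReal.ofReal c⁻¹ * 0)) :=
    ENNReal.Tendsto.const_mul hg (Or.inr ENNReal.ofReal_ne_top)
  rw [mul_zero, ENNReal.tendsto_nhds_zero] at h2
  filter_upwards [h2 (ε / 2) (ENNReal.half_pos hε.ne')] with M hM
  refine (h c hc M).trans ((add_le_add hcK hM).trans ?_)
  rw [ENNReal.add_halves]

/-- Compressions to finitely many levels converge in trace norm: with `R = |T|^{1/2}`, both
factors of `T = (U R) R` are Hilbert-Schmidt operators. -/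
theorem tendsto_eTraceNorm_sub_compression (b : HilbertBasis ℕ ℂ 𝓗) {T : 𝓗 →L[ℂ] 𝓗}
    (hT : eTraceNorm b T ≠ ∞) :
    Tendsto (fun M => eTraceNorm b (T - levelProj b M * T * levelProj b M)) atTop (𝓝 0) := by
  obtain ⟨U, hU, hU1, -⟩ := exists_polar T
  set R := CFC.sqrt (CFC.abs T) with hR
  have hRR : R * R = CFC.abs T := CFC.sqrt_mul_sqrt_self _ (CFC.abs_nonneg T)
  have hRtop : eHilbertSchmidtSq b R ≠ ∞ := by rwa [← eTraceNorm_eq]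
  set A := U * R with hA
  have hAtop : eHilbertSchmidtSq b A ≠ ∞ :=
    ((eHilbertSchmidtSq_mul_left_le b U R hU).trans_lt hRtop.lt_top).ne
  have hAR : A * R = T := by rw [hA, mul_assoc, hRR, hU1]
  have hE : ∀ M, ‖levelProj b M‖ ≤ 1 := fun M => by
    have h1 : ‖star (levelProj b M) * levelProj b M‖ = ‖levelProj b M‖ * ‖levelProj b M‖ :=
      CStarRing.norm_star_mul_self
    rw [star_levelProj, levelProj_mul_self] at h1
    nlinarith [norm_nonneg (levelProj b M)]
  have t1 : Tendsto (fun M => eTraceNorm b (T * (1 - levelProj b M))) atTop (𝓝 0) := by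
    refine ENNReal.tendsto_zero_of_le_mul_add_inv_mul hAtop
      (tendsto_eHilbertSchmidtSq_mul_compl b R hRtop)
      fun c hc M => ?_
    rw [← hAR, mul_assoc]
    exact eTraceNorm_mul_le b _ _ hc
  have t2 : Tendsto (fun M => eTraceNorm b ((1 - levelProj b M) * T * levelProj b M)) atTop
      (𝓝 0) := by
    refine ENNReal.tendsto_zero_of_le_mul_add_inv_mul hRtop
      (tendsto_eHilbertSchmidtSq_mul_compl b (star A)
      (by rwa [eHilbertSchmidtSq_adjoint])) fun c hc M => ?_
    have e1 : (1 - levelProj b M) * T * levelProj b M =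
        ((1 - levelProj b M) * A) * (R * levelProj b M) := by
      rw [← hAR]; simp only [mul_assoc]
    have e2 : eHilbertSchmidtSq b ((1 - levelProj b M) * A) =
        eHilbertSchmidtSq b (star A * (1 - levelProj b M)) := by
      rw [← eHilbertSchmidtSq_adjoint, star_mul, star_sub, star_one, star_levelProj]
    rw [e1, ← e2, add_comm]
    refine (eTraceNorm_mul_le b _ _ (inv_pos.2 hc)).trans ?_
    rw [inv_inv]
    gcongr
    exact eHilbertSchmidtSq_mul_right_le b _ _ (hE M)
  have t3 := t1.add t2
  rw [add_zero] at t3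
  refine tendsto_of_tendsto_of_tendsto_of_le_of_le tendsto_const_nhds t3 (fun _ => zero_le)
    fun M => ?_
  have e : T - levelProj b M * T * levelProj b M =
      T * (1 - levelProj b M) + (1 - levelProj b M) * T * levelProj b M := by
    simp only [mul_sub, sub_mul, mul_one, one_mul]; abel
  dsimp only
  rw [e]
  exact eTraceNorm_add_le b _ _

theorem eTraceNorm_rankOne_basis_le (b : HilbertBasis ℕ ℂ 𝓗) (i j : ℕ) :
    eTraceNorm b (InnerProductSpace.rankOne ℂ (b i) (b j)) ≤ 1 := by
  obtain ⟨U, hU, -, hU2⟩ := exists_polar (InnerProductSpace.rankOne ℂ (b i) (b j))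
  have ho := orthonormal_iff_ite.1 b.orthonormal
  rw [eTraceNorm, tsum_eq_single j]
  · rw [← hU2, mul_apply_eq_comp, ContinuousLinearMap.star_eq_adjoint,
      ContinuousLinearMap.adjoint_inner_right, InnerProductSpace.rankOne_apply, ho, if_pos rfl,
      one_smul, ← ENNReal.ofReal_one]
    refine ENNReal.ofReal_le_ofReal ((re_inner_le_norm _ _).trans ?_)
    rw [b.orthonormal.1 i, mul_one]
    exact (U.le_of_opNorm_le hU _).trans (by rw [b.orthonormal.1 j, mul_one])
  · intro n hn
    rw [← hU2, mul_apply_eq_comp, ContinuousLinearMap.star_eq_adjoint,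
      ContinuousLinearMap.adjoint_inner_right, InnerProductSpace.rankOne_apply, ho,
      if_neg (Ne.symm hn)]
    simp

/-- The operator `|i⟩⟨j|` as an element of the trace class. -/
def TraceClass.unit (b : HilbertBasis ℕ ℂ 𝓗) (i j : ℕ) : TraceClass b :=
  TraceClass.mk b (InnerProductSpace.rankOne ℂ (b i) (b j))
    ((eTraceNorm_rankOne_basis_le b i j).trans_lt ENNReal.one_lt_top)

theorem TraceClass.toOp_unit (b : HilbertBasis ℕ ℂ 𝓗) (i j : ℕ) :
    (TraceClass.unit b i j).toOp = InnerProductSpace.rankOne ℂ (b i) (b j) := rfl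

theorem TraceClass.norm_unit_le (b : HilbertBasis ℕ ℂ 𝓗) (i j : ℕ) :
    ‖TraceClass.unit b i j‖ ≤ 1 :=
  TraceClass.norm_le_of_eTraceNorm_le zero_le_one
    ((eTraceNorm_rankOne_basis_le b i j).trans ENNReal.ofReal_one.ge)

/-- The finite linear combinations of the `|i⟩⟨j|`, as trace-class operators. -/
def TraceClass.ofFinsupp (b : HilbertBasis ℕ ℂ 𝓗) : (ℕ × ℕ →₀ ℂ) →ₗ[ℂ] TraceClass b :=
  Finsupp.linearCombination ℂ fun ij => TraceClass.unit b ij.1 ij.2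

theorem TraceClass.ofFinsupp_single (b : HilbertBasis ℕ ℂ 𝓗) (i j : ℕ) (c : ℂ) :
    TraceClass.ofFinsupp b (Finsupp.single (i, j) c) = c • TraceClass.unit b i j := by
  simp [TraceClass.ofFinsupp]

theorem compression_eq_sum (b : HilbertBasis ℕ ℂ 𝓗) (T : 𝓗 →L[ℂ] 𝓗) (M : ℕ) :
    levelProj b M * T * levelProj b M = ∑ i ∈ Finset.range M, ∑ j ∈ Finset.range M,
      ⟪b i, T (b j)⟫_ℂ • InnerProductSpace.rankOne ℂ (b i) (b j) := by
  refine ContinuousLinearMap.ext fun x => ?_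
  simp only [levelProj, mul_apply_eq_comp, sum_apply, InnerProductSpace.rankOne_apply, map_sum,
    map_smul, smul_apply]
  rw [Finset.sum_comm]
  simp only [Finset.smul_sum]
  refine Finset.sum_congr rfl fun i _ => Finset.sum_congr rfl fun j _ => ?_
  rw [smul_smul, smul_smul, mul_comm]

theorem TraceClass.denseRange_ofFinsupp (b : HilbertBasis ℕ ℂ 𝓗) :
    DenseRange (TraceClass.ofFinsupp b) := by
  intro T
  have h := tendsto_eTraceNorm_sub_compression b (ne_of_lt T.2 : eTraceNorm b T.toOp ≠ ∞)
  let v : ℕ → (ℕ × ℕ →₀ ℂ) := fun M => ∑ i ∈ Finset.range M, ∑ j ∈ Finset.range M,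
    Finsupp.single (i, j) ⟪b i, T.toOp (b j)⟫_ℂ
  have hv : ∀ M, (TraceClass.ofFinsupp b (v M)).toOp =
      levelProj b M * T.toOp * levelProj b M := fun M => by
    rw [compression_eq_sum]
    simp only [v, map_sum, TraceClass.ofFinsupp_single, map_smul, TraceClass.toOp_unit]
  refine mem_closure_of_tendsto (f := fun M => TraceClass.ofFinsupp b (v M)) (b := atTop) ?_
    (Eventually.of_forall fun M => ⟨v M, rfl⟩)
  rw [tendsto_iff_norm_sub_tendsto_zero]
  have h2 := (ENNReal.tendsto_toReal ENNReal.zero_ne_top).comp h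
  refine h2.congr fun M => ?_
  rw [norm_sub_rev, TraceClass.norm_def, map_sub, hv]
  rfl

end TraceClassTheory

/-! ### Strongly continuous semigroups and their generators -/

noncomputable section SemigroupTheory

namespace C0Semigroup

variable {E : Type*} [NormedAddCommGroup E] [NormedSpace ℂ E]

theorem ext_op {Φ Ψ : C0Semigroup E} (h : ∀ t x, Φ.op t x = Ψ.op t x) : Φ = Ψ := by
  have h1 : Φ.op = Ψ.op := funext fun t => ContinuousLinearMap.ext (h t)
  cases Φ
  cases Ψ
  congr

theorem exists_bound [CompleteSpace E] (Ψ : C0Semigroup E) (T : ℝ≥0) :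
    ∃ K : ℝ, 0 ≤ K ∧ ∀ s ≤ T, ∀ x, ‖Ψ.op s x‖ ≤ K * ‖x‖ := by
  have h : ∀ x, ∃ C, ∀ s : Set.Iic T, ‖Ψ.op s x‖ ≤ C := fun x => by
    have hc : IsCompact ((fun s => Ψ.op s x) '' Set.Icc 0 T) :=
      isCompact_Icc.image (Ψ.continuous_orbit x)
    obtain ⟨C, hC⟩ := hc.isBounded.exists_norm_le
    exact ⟨C, fun s => hC _ ⟨s, ⟨zero_le, s.2⟩, rfl⟩⟩
  obtain ⟨K, hK⟩ := banach_steinhaus h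
  refine ⟨max K 0, le_max_right _ _, fun s hs x => ?_⟩
  exact (Ψ.op s).le_of_opNorm_le ((hK ⟨s, hs⟩).trans (le_max_left _ _)) x

theorem HasDerivAtZero.hasDerivWithinAt {Φ : C0Semigroup E} {x y : E}
    (h : Φ.HasDerivAtZero x y) (s : ℝ) (hs : 0 ≤ s) :
    HasDerivWithinAt (fun r : ℝ => Φ.op r.toNNReal x) (Φ.op s.toNNReal y) (Set.Ici s) s := by
  rw [← hasDerivWithinAt_Ioi_iff_Ici, hasDerivWithinAt_iff_tendsto_slope' (by simp)]
  have hm : Tendsto (fun r : ℝ => (r - s).toNNReal) (𝓝[>] s) (𝓝[≠] 0) := by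
    refine tendsto_nhdsWithin_of_tendsto_nhds_of_eventually_within _ ?_ ?_
    · have : Tendsto (fun r : ℝ => (r - s).toNNReal) (𝓝 s) (𝓝 (s - s).toNNReal) :=
        (continuous_real_toNNReal.comp (continuous_sub_right s)).tendsto s
      rw [sub_self, Real.toNNReal_zero] at this
      exact this.mono_left nhdsWithin_le_nhds
    · filter_upwards [self_mem_nhdsWithin] with r hr
      have : 0 < r - s := sub_pos.2 hr
      exact (Real.toNNReal_pos.2 this).ne'
  refine (((Φ.op s.toNNReal).continuous.tendsto y).comp (Tendsto.comp h hm)).congr' ?_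
  filter_upwards [self_mem_nhdsWithin] with r hr
  have hrs : 0 < r - s := sub_pos.2 hr
  have e : r.toNNReal = s.toNNReal + (r - s).toNNReal := by
    rw [← Real.toNNReal_add hs hrs.le, add_sub_cancel]
  simp only [Function.comp_apply, slope_def_module]
  rw [e, Φ.op_add, ContinuousLinearMap.comp_apply, ← map_sub, map_smul,
    Real.coe_toNNReal _ hrs.le, ← Complex.ofReal_inv, Complex.coe_smul]

theorem continuous_orbit_toNNReal (Φ : C0Semigroup E) (x : E) :
    Continuous fun r : ℝ => Φ.op r.toNNReal x :=
  (Φ.continuous_orbit x).comp continuous_real_toNNReal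

/-- The mean value inequality along an orbit. -/
theorem HasDerivAtZero.norm_sub_sub_le {Φ : C0Semigroup E} {x y : E}
    (h : Φ.HasDerivAtZero x y) {t : ℝ≥0} {C : ℝ} (hC : ∀ s ≤ t, ‖Φ.op s y - y‖ ≤ C) :
    ‖Φ.op t x - x - (t : ℝ) • y‖ ≤ C * t := by
  have h1 := norm_image_sub_le_of_norm_deriv_right_le_segment
    (f := fun r : ℝ => Φ.op r.toNNReal x - r • y) (f' := fun r => Φ.op r.toNNReal y - y)
    (a := 0) (b := t) (C := C)
    ((Φ.continuous_orbit_toNNReal x).sub (by fun_prop)).continuousOn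
    (fun s hs => by
      refine (h.hasDerivWithinAt s hs.1).sub ?_
      simpa using ((hasDerivAt_id s).smul_const y).hasDerivWithinAt)
    (fun s hs => hC _ (Real.toNNReal_le_iff_le_coe.2 hs.2.le)) t ⟨t.2, le_rfl⟩
  simpa [Φ.op_zero, sub_right_comm] using h1

theorem hasDerivAtZero_of_norm_sub_sub_le {Φ : C0Semigroup E} {x y : E}
    (h : ∀ ε > 0, ∀ᶠ t : ℝ≥0 in 𝓝 0, ‖Φ.op t x - x - (t : ℝ) • y‖ ≤ ε * t) :
    Φ.HasDerivAtZero x y := by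
  rw [HasDerivAtZero, Metric.tendsto_nhds]
  intro ε hε
  filter_upwards [nhdsWithin_le_nhds (h (ε / 2) (half_pos hε)), self_mem_nhdsWithin] with t ht ht0
  have ht' : 0 < (t : ℝ) := NNReal.coe_pos.2 (pos_iff_ne_zero.2 ht0)
  have e : ((t : ℝ) : ℂ)⁻¹ • (Φ.op t x - x) - y =
      (t : ℝ)⁻¹ • (Φ.op t x - x - (t : ℝ) • y) := by
    rw [smul_sub (t : ℝ)⁻¹, smul_smul, inv_mul_cancel₀ ht'.ne', one_smul, ← Complex.ofReal_inv,
      Complex.coe_smul]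
  rw [dist_eq_norm, e, norm_smul, norm_inv, Real.norm_of_nonneg ht'.le, inv_mul_lt_iff₀ ht']
  nlinarith

/-- The generator of a strongly continuous semigroup is closed. -/
theorem isClosed_hasDerivAtZero [CompleteSpace E] (Φ : C0Semigroup E) :
    IsClosed {p : E × E | Φ.HasDerivAtZero p.1 p.2} := by
  refine isClosed_of_closure_subset fun p hp => ?_
  obtain ⟨u, hu, hlim⟩ := mem_closure_iff_seq_limit.1 hp
  obtain ⟨K, hK0, hK⟩ := Φ.exists_bound 1
  have h1 : Tendsto (fun n => (u n).1) atTop (𝓝 p.1) := (continuous_fst.tendsto p).comp hlim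
  have h2 : Tendsto (fun n => (u n).2) atTop (𝓝 p.2) := (continuous_snd.tendsto p).comp hlim
  refine hasDerivAtZero_of_norm_sub_sub_le fun ε hε => ?_
  have hc : ∀ᶠ t : ℝ≥0 in 𝓝 0, ∀ s ≤ t, ‖Φ.op s p.2 - p.2‖ ≤ ε / 2 := by
    have h3 : Tendsto (fun s => ‖Φ.op s p.2 - p.2‖) (𝓝 0) (𝓝 ‖Φ.op 0 p.2 - p.2‖) :=
      (((Φ.continuous_orbit p.2).sub continuous_const).norm).tendsto 0
    rw [Φ.op_zero, ContinuousLinearMap.id_apply, sub_self, norm_zero] at h3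
    have h4 := h3.eventually (gt_mem_nhds (half_pos hε))
    obtain ⟨δ, hδ, h5⟩ := Metric.eventually_nhds_iff.1 h4
    filter_upwards [Metric.ball_mem_nhds (0 : ℝ≥0) hδ] with t ht s hs
    refine (h5 ?_).le
    refine lt_of_le_of_lt ?_ ht
    rw [NNReal.dist_eq, NNReal.dist_eq, NNReal.coe_zero, sub_zero, sub_zero,
      NNReal.abs_eq, NNReal.abs_eq]
    exact hs
  have h6 : ∀ᶠ t : ℝ≥0 in 𝓝 0, t ≤ 1 := (eventually_lt_nhds one_pos).mono fun _ => le_of_lt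
  filter_upwards [hc, h6] with t ht ht1
  have h7 : ∀ n, ‖Φ.op t (u n).1 - (u n).1 - (t : ℝ) • (u n).2‖ ≤
      (ε / 2 + (K + 1) * ‖(u n).2 - p.2‖) * t := fun n => by
    refine (hu n).norm_sub_sub_le fun s hs => ?_
    have e : Φ.op s (u n).2 - (u n).2 = (Φ.op s p.2 - p.2) + Φ.op s ((u n).2 - p.2) -
        ((u n).2 - p.2) := by rw [map_sub]; abel
    rw [e]
    have h8 := hK s (hs.trans ht1) ((u n).2 - p.2)
    linarith [norm_sub_le ((Φ.op s p.2 - p.2) + Φ.op s ((u n).2 - p.2)) ((u n).2 - p.2),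
      norm_add_le (Φ.op s p.2 - p.2) (Φ.op s ((u n).2 - p.2)), ht s hs]
  have h9 : Tendsto (fun n => ‖Φ.op t (u n).1 - (u n).1 - (t : ℝ) • (u n).2‖) atTop
      (𝓝 ‖Φ.op t p.1 - p.1 - (t : ℝ) • p.2‖) :=
    (((((Φ.op t).continuous.tendsto _).comp h1).sub h1).sub (h2.const_smul (t : ℝ))).norm
  have h10 : Tendsto (fun n => (ε / 2 + (K + 1) * ‖(u n).2 - p.2‖) * t) atTop
      (𝓝 ((ε / 2 + (K + 1) * ‖p.2 - p.2‖) * t)) :=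
    ((((h2.sub_const p.2).norm).const_mul (K + 1)).const_add (ε / 2)).mul_const _
  refine (le_of_tendsto_of_tendsto' h9 h10 h7).trans ?_
  rw [sub_self, norm_zero, mul_zero, add_zero]
  nlinarith [show (0 : ℝ) ≤ t from t.2]

theorem generator_spec (Φ : C0Semigroup E) (x : Φ.generator.domain) :
    Φ.HasDerivAtZero x (Φ.generator x) := Classical.choose_spec x.2

theorem HasDerivAtZero.exists_generator_eq {Φ : C0Semigroup E} {x y : E}
    (h : Φ.HasDerivAtZero x y) : ∃ hx : x ∈ Φ.generator.domain, Φ.generator ⟨x, hx⟩ = y :=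
  ⟨⟨y, h⟩, (Φ.generator_spec ⟨x, ⟨y, h⟩⟩).unique h⟩

end C0Semigroup

/-! ### Resolvents of m-dissipative operators -/

/-- `ι : V → E` and `L : V → E` describe a densely defined operator `ι v ↦ L v` on `E`, which is
dissipative and for which `z - L` has dense range whenever `Re z > 0`. -/
structure IsMDissipativeCore {V E : Type*} [AddCommGroup V] [Module ℂ V] [NormedAddCommGroup E]
    [NormedSpace ℂ E] (ι L : V →ₗ[ℂ] E) : Prop where
  dense : DenseRange ι
  dissipative : ∀ z : ℂ, 0 < z.re → ∀ v, z.re * ‖ι v‖ ≤ ‖z • ι v - L v‖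
  denseRange_sub : ∀ z : ℂ, 0 < z.re → DenseRange (z • ι - L)

/-- The resolvent `(z - L)⁻¹` of the closure of `ι v ↦ L v`. -/
def coreResolvent {V E : Type*} [AddCommGroup V] [Module ℂ V] [NormedAddCommGroup E]
    [NormedSpace ℂ E] [CompleteSpace E] (ι L : V →ₗ[ℂ] E) (z : ℂ) : E →L[ℂ] E :=
  LinearMap.extendOfNorm ι (z • ι - L)

namespace IsMDissipativeCore

variable {V E : Type*} [AddCommGroup V] [Module ℂ V] [NormedAddCommGroup E]
    [NormedSpace ℂ E] {ι L : V →ₗ[ℂ] E}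

theorem norm_le (h : IsMDissipativeCore ι L) {z : ℂ} (hz : 0 < z.re) (v : V) :
    ‖ι v‖ ≤ z.re⁻¹ * ‖(z • ι - L) v‖ := by
  rw [le_inv_mul_iff₀ hz]
  exact h.dissipative z hz v

variable [CompleteSpace E]

theorem resolvent_apply (h : IsMDissipativeCore ι L) {z : ℂ} (hz : 0 < z.re) (v : V) :
    coreResolvent ι L z (z • ι v - L v) = ι v :=
  LinearMap.extendOfNorm_eq (h.denseRange_sub z hz) ⟨_, h.norm_le hz⟩ v

theorem norm_resolvent_apply_le (h : IsMDissipativeCore ι L) {z : ℂ} (hz : 0 < z.re) (x : E) :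
    ‖coreResolvent ι L z x‖ ≤ z.re⁻¹ * ‖x‖ :=
  LinearMap.norm_extendOfNorm_apply_le (h.denseRange_sub z hz) _ (h.norm_le hz) x

theorem resolvent_identity (h : IsMDissipativeCore ι L) {z w : ℂ} (hz : 0 < z.re) (hw : 0 < w.re)
    (x : E) : coreResolvent ι L z x - coreResolvent ι L w x =
      (w - z) • coreResolvent ι L z (coreResolvent ι L w x) := by
  refine (h.denseRange_sub w hw).induction_on (p := fun x => coreResolvent ι L z x -
    coreResolvent ι L w x = (w - z) • coreResolvent ι L z (coreResolvent ι L w x)) x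
    (isClosed_eq (by fun_prop) (by fun_prop)) fun v => ?_
  have e : (w • ι - L) v = (z • ι v - L v) + (w - z) • ι v := by
    simp only [LinearMap.sub_apply, LinearMap.smul_apply, sub_smul]; abel
  have e1 : coreResolvent ι L w ((w • ι - L) v) = ι v := h.resolvent_apply hw v
  rw [e1, e, map_add, h.resolvent_apply hz, map_smul, add_sub_cancel_left]

theorem resolvent_comm (h : IsMDissipativeCore ι L) {z w : ℂ} (hz : 0 < z.re) (hw : 0 < w.re)
    (x : E) : coreResolvent ι L z (coreResolvent ι L w x) =
      coreResolvent ι L w (coreResolvent ι L z x) := by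
  by_cases hzw : w = z
  · rw [hzw]
  have h1 := h.resolvent_identity hz hw x
  have h2 := h.resolvent_identity hw hz x
  have h3 : (w - z) • coreResolvent ι L z (coreResolvent ι L w x) =
      (w - z) • coreResolvent ι L w (coreResolvent ι L z x) := by
    rw [← h1, ← neg_sub, h2, ← neg_smul, neg_sub]
  exact smul_right_injective E (sub_ne_zero.2 hzw) h3

/-- With `R = (z - L)⁻¹`, the pairs `(R x, z R x - x)` belong to the closure of the graph of
`ι v ↦ L v`. -/
theorem mem_of_isClosed (h : IsMDissipativeCore ι L) {G : Set (E × E)} (hG : IsClosed G)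
    (hL : ∀ v, (ι v, L v) ∈ G) {z : ℂ} (hz : 0 < z.re) (x : E) :
    (coreResolvent ι L z x, z • coreResolvent ι L z x - x) ∈ G := by
  refine (h.denseRange_sub z hz).induction_on (p := fun x =>
    (coreResolvent ι L z x, z • coreResolvent ι L z x - x) ∈ G) x
    (hG.preimage (by fun_prop)) fun v => ?_
  have e1 : coreResolvent ι L z ((z • ι - L) v) = ι v := h.resolvent_apply hz v
  have e2 : z • ι v - (z • ι - L) v = L v := by
    rw [LinearMap.sub_apply, LinearMap.smul_apply, sub_sub_cancel]
  rw [e1, e2]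
  exact hL v

theorem denseRange_resolvent (h : IsMDissipativeCore ι L) {z : ℂ} (hz : 0 < z.re) :
    DenseRange (coreResolvent ι L z) := by
  refine h.dense.mono ?_
  rintro _ ⟨v, rfl⟩
  exact ⟨_, h.resolvent_apply hz v⟩

theorem natSucc_re_pos (n : ℕ) : 0 < (((n + 1 : ℝ) : ℂ)).re := by
  rw [Complex.ofReal_re]; positivity

theorem norm_smul_resolvent_le (h : IsMDissipativeCore ι L) (n : ℕ) (y : E) :
    ‖((n + 1 : ℝ) : ℂ) • coreResolvent ι L ((n + 1 : ℝ) : ℂ) y‖ ≤ ‖y‖ := by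
  have h1 := h.norm_resolvent_apply_le (natSucc_re_pos n) y
  have h2 : (0 : ℝ) < n + 1 := by positivity
  rw [Complex.ofReal_re, le_inv_mul_iff₀ h2] at h1
  rwa [norm_smul, Complex.norm_real, Real.norm_of_nonneg h2.le]

theorem tendsto_smul_resolvent (h : IsMDissipativeCore ι L) (x : E) :
    Tendsto (fun n : ℕ => ((n + 1 : ℝ) : ℂ) • coreResolvent ι L ((n + 1 : ℝ) : ℂ) x) atTop
      (𝓝 x) := by
  rw [Metric.tendsto_atTop]
  intro ε hε
  obtain ⟨v, hv⟩ := h.dense.exists_dist_lt x (show 0 < ε / 3 by positivity)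
  rw [dist_eq_norm] at hv
  obtain ⟨N, hN⟩ := exists_nat_gt (‖L v‖ / (ε / 3))
  refine ⟨N, fun n hn => ?_⟩
  have h2 : (0 : ℝ) < n + 1 := by positivity
  set R := coreResolvent ι L ((n + 1 : ℝ) : ℂ)
  have e1 : ((n + 1 : ℝ) : ℂ) • R (ι v) - ι v = R (L v) := by
    have h3 := h.resolvent_apply (natSucc_re_pos n) v
    rw [map_sub, map_smul, sub_eq_iff_eq_add] at h3
    rw [h3, add_sub_cancel_left]
  have e2 : ((n + 1 : ℝ) : ℂ) • R x - x =
      ((n + 1 : ℝ) : ℂ) • R (x - ι v) + R (L v) - (x - ι v) := by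
    rw [← e1, map_sub, smul_sub]; abel
  have h4 : ‖R (L v)‖ < ε / 3 := by
    refine (h.norm_resolvent_apply_le (natSucc_re_pos n) (L v)).trans_lt ?_
    rw [Complex.ofReal_re, inv_mul_lt_iff₀ h2]
    rw [div_lt_iff₀ (by positivity)] at hN
    have h5 : (N : ℝ) ≤ n := Nat.cast_le.2 hn
    nlinarith
  rw [dist_eq_norm, e2]
  linarith [norm_sub_le (((n + 1 : ℝ) : ℂ) • R (x - ι v) + R (L v)) (x - ι v),
    norm_add_le (((n + 1 : ℝ) : ℂ) • R (x - ι v)) (R (L v)), h.norm_smul_resolvent_le n (x - ι v)]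

end IsMDissipativeCore

end SemigroupTheory

/-! ### Contraction semigroups with bounded generators -/

noncomputable section BoundedGenerators

open NormedSpace

variable {E : Type*} [NormedAddCommGroup E] [NormedSpace ℂ E] [CompleteSpace E]

theorem norm_exp_le_exp_norm (X : E →L[ℂ] E) : ‖exp X‖ ≤ Real.exp ‖X‖ := by
  have h := exp_series_hasSum_exp' (𝕂 := ℝ) ‖X‖
  rw [← Real.exp_eq_exp_ℝ] at h
  rw [← (exp_series_hasSum_exp' (𝕂 := ℝ) X).tsum_eq]
  refine tsum_of_norm_bounded h fun n => ?_
  rw [norm_smul, norm_inv, RCLike.norm_natCast, smul_eq_mul]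
  rcases Nat.eq_zero_or_pos n with rfl | hn
  · have h1 : ‖(1 : E →L[ℂ] E)‖ ≤ 1 := ContinuousLinearMap.norm_id_le
    simpa using h1
  · gcongr
    exact norm_pow_le' X hn

theorem norm_exp_smul_sub_one_le {T : E →L[ℂ] E} (hT : ‖T‖ ≤ 1) {c : ℝ} (hc : 0 ≤ c) :
    ‖exp (c • (T - 1))‖ ≤ 1 := by
  let _ := NormedAlgebra.restrictScalars ℚ ℝ (E →L[ℂ] E)
  have e : c • (T - 1) = algebraMap ℝ (E →L[ℂ] E) (-c) + c • T := by
    rw [Algebra.algebraMap_eq_smul_one, smul_sub, neg_smul]; abel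
  rw [e, exp_add_of_commute (Algebra.commutes _ _), ← algebraMap_exp_comm,
    Algebra.algebraMap_eq_smul_one, smul_mul_assoc, one_mul, norm_smul, ← Real.exp_eq_exp_ℝ,
    Real.norm_of_nonneg (Real.exp_pos _).le]
  have h1 : ‖c • T‖ ≤ c := by
    rw [norm_smul, Real.norm_of_nonneg hc]
    exact mul_le_of_le_one_right hc hT
  calc Real.exp (-c) * ‖exp (c • T)‖ ≤ Real.exp (-c) * Real.exp c := by
        gcongr
        exact (norm_exp_le_exp_norm _).trans (Real.exp_le_exp.2 h1)
    _ = 1 := by rw [← Real.exp_add, neg_add_cancel, Real.exp_zero]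

theorem exp_add_smul (B : E →L[ℂ] E) (s t : ℝ) :
    exp ((s + t) • B) = exp (s • B) * exp (t • B) := by
  let _ := NormedAlgebra.restrictScalars ℚ ℝ (E →L[ℂ] E)
  rw [add_smul]
  exact exp_add_of_commute (((Commute.refl B).smul_left s).smul_right t)

theorem hasDerivAt_apply {E : Type*} [NormedAddCommGroup E] [NormedSpace ℂ E] {P : ℝ → E →L[ℂ] E}
    {P' : E →L[ℂ] E} {t : ℝ} (h : HasDerivAt P P' t) (x : E) :
    HasDerivAt (fun s => P s x) (P' x) t :=
  ((ContinuousLinearMap.apply ℂ E x).restrictScalars ℝ).hasFDerivAt.comp_hasDerivAt t h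

theorem norm_exp_smul_apply_sub_sub_le {B : E →L[ℂ] E} {x y : E} {t C : ℝ} (ht : 0 ≤ t)
    (hC : ∀ s : ℝ, 0 ≤ s → s ≤ t → ‖exp (s • B) (B x) - y‖ ≤ C) :
    ‖exp (t • B) x - x - t • y‖ ≤ C * t := by
  have h1 := norm_image_sub_le_of_norm_deriv_le_segment' (a := 0) (b := t) (C := C)
    (f := fun r : ℝ => exp (r • B) x - r • y) (f' := fun r => exp (r • B) (B x) - y)
    (fun s _ => by
      have h2 := hasDerivAt_apply (hasDerivAt_exp_smul_const B s) x
      have h3 := (hasDerivAt_id s).smul_const y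
      simp only [id_eq, one_smul] at h3
      exact (h2.sub h3).hasDerivWithinAt)
    (fun s hs => hC s hs.1 hs.2.le) t ⟨ht, le_rfl⟩
  simpa [sub_right_comm] using h1

/-- Two commuting contraction semigroups differ by at most the difference of their generators:
differentiate `exp ((t - s) C) exp (s B) x` in `s`. -/
theorem norm_exp_smul_apply_sub_le {B C : E →L[ℂ] E} (hBC : Commute B C)
    (hB : ∀ s : ℝ, 0 ≤ s → ‖exp (s • B)‖ ≤ 1) (hC : ∀ s : ℝ, 0 ≤ s → ‖exp (s • C)‖ ≤ 1)
    (x : E) {t : ℝ} (ht : 0 ≤ t) :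
    ‖exp (t • B) x - exp (t • C) x‖ ≤ ‖B x - C x‖ * t := by
  let _ := NormedAlgebra.restrictScalars ℚ ℝ (E →L[ℂ] E)
  have h1 := norm_image_sub_le_of_norm_deriv_le_segment' (a := 0) (b := t) (C := ‖B x - C x‖)
    (f := fun s : ℝ => (exp ((t - s) • C) * exp (s • B)) x)
    (f' := fun s => (exp ((t - s) • C) * exp (s • B)) (B x - C x))
    (fun s _ => by
      have h2 : HasDerivAt (fun s : ℝ => exp ((t - s) • C)) (-(exp ((t - s) • C) * C)) s := by
        have h3 := HasDerivAt.scomp s (hasDerivAt_exp_smul_const C (t - s))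
          ((hasDerivAt_id s).const_sub t)
        simpa [Function.comp_def] using h3
      have h4 := hasDerivAt_apply (h2.mul (hasDerivAt_exp_smul_const B s)) x
      have e : (exp ((t - s) • C) * exp (s • B)) (B x - C x) =
          (-(exp ((t - s) • C) * C) * exp (s • B) +
            exp ((t - s) • C) * (exp (s • B) * B)) x := by
        have h5 : C * exp (s • B) = exp (s • B) * C :=
          ((hBC.symm.smul_right s).exp_right).eq
        rw [neg_mul, mul_assoc _ C, h5, map_sub]
        simp only [mul_apply_eq_comp, add_apply, neg_apply]
        abel
      rw [e]
      exact h4.hasDerivWithinAt)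
    (fun s hs => by
      refine (ContinuousLinearMap.le_of_opNorm_le _ (c := 1) ?_ _).trans_eq (one_mul _)
      exact (norm_mul_le _ _).trans (mul_le_one₀ (hC _ (sub_nonneg.2 hs.2.le)) (norm_nonneg _)
        (hB _ hs.1))) t ⟨ht, le_rfl⟩
  simpa using h1

end BoundedGenerators

/-! ### The semigroup generated by an m-dissipative operator -/

noncomputable section LumerPhillips

open NormedSpace

namespace IsMDissipativeCore

variable {V E : Type*} [AddCommGroup V] [Module ℂ V] [NormedAddCommGroup E]
    [NormedSpace ℂ E] [CompleteSpace E] {ι L : V →ₗ[ℂ] E}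

/-- The Yosida approximation `λ (λ (λ - L)⁻¹ - 1)` with `λ = n + 1`. -/
def yosida (ι L : V →ₗ[ℂ] E) (n : ℕ) : E →L[ℂ] E :=
  (n + 1 : ℝ) • (((n + 1 : ℝ) : ℂ) • coreResolvent ι L ((n + 1 : ℝ) : ℂ) - 1)

theorem norm_exp_yosida_le (h : IsMDissipativeCore ι L) (n : ℕ) (s : ℝ) (hs : 0 ≤ s) :
    ‖exp (s • yosida ι L n)‖ ≤ 1 := by
  rw [yosida, smul_smul]
  refine norm_exp_smul_sub_one_le ?_ (by positivity)
  exact ContinuousLinearMap.opNorm_le_bound _ zero_le_one fun y => by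
    rw [one_mul]
    exact h.norm_smul_resolvent_le n y

theorem commute_yosida_resolvent (h : IsMDissipativeCore ι L) (n : ℕ) {z : ℂ} (hz : 0 < z.re) :
    Commute (yosida ι L n) (coreResolvent ι L z) := by
  have h1 : Commute (coreResolvent ι L ((n + 1 : ℝ) : ℂ)) (coreResolvent ι L z) :=
    ContinuousLinearMap.ext fun x => h.resolvent_comm (natSucc_re_pos n) hz x
  exact ((h1.smul_left _).sub_left (Commute.one_left _)).smul_left _

theorem commute_yosida (h : IsMDissipativeCore ι L) (m n : ℕ) :
    Commute (yosida ι L m) (yosida ι L n) := by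
  have h1 := h.commute_yosida_resolvent m (natSucc_re_pos n)
  exact ((h1.smul_right _).sub_right (Commute.one_right _)).smul_right _

theorem yosida_apply (h : IsMDissipativeCore ι L) (n : ℕ) (v : V) :
    yosida ι L n (ι v) = ((n + 1 : ℝ) : ℂ) • coreResolvent ι L ((n + 1 : ℝ) : ℂ) (L v) := by
  have h3 := h.resolvent_apply (natSucc_re_pos n) v
  rw [map_sub, map_smul, sub_eq_iff_eq_add] at h3
  rw [yosida, smul_apply, sub_apply, smul_apply, one_apply_eq_self, h3,
    add_sub_cancel_left, Complex.coe_smul]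

theorem tendsto_yosida (h : IsMDissipativeCore ι L) (v : V) :
    Tendsto (fun n => yosida ι L n (ι v)) atTop (𝓝 (L v)) :=
  (h.tendsto_smul_resolvent (L v)).congr fun n => (h.yosida_apply n v).symm

theorem norm_yosida_le (h : IsMDissipativeCore ι L) (n : ℕ) (v : V) :
    ‖yosida ι L n (ι v)‖ ≤ ‖L v‖ := by
  rw [h.yosida_apply]
  exact h.norm_smul_resolvent_le n _

theorem norm_exp_yosida_apply_le (h : IsMDissipativeCore ι L) (n : ℕ) {s : ℝ} (hs : 0 ≤ s)
    (x : E) : ‖exp (s • yosida ι L n) x‖ ≤ ‖x‖ :=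
  ((exp (s • yosida ι L n)).le_of_opNorm_le (h.norm_exp_yosida_le n s hs) x).trans_eq (one_mul _)

theorem exists_tendsto_exp_yosida (h : IsMDissipativeCore ι L) {t : ℝ} (ht : 0 ≤ t) (x : E) :
    ∃ y, Tendsto (fun n => exp (t • yosida ι L n) x) atTop (𝓝 y) := by
  refine cauchySeq_tendsto_of_complete ?_
  rw [Metric.cauchySeq_iff]
  intro ε hε
  obtain ⟨v, hv⟩ := h.dense.exists_dist_lt x (show 0 < ε / 3 by positivity)
  rw [dist_eq_norm] at hv
  have hA := (h.tendsto_yosida v).cauchySeq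
  obtain ⟨N, hN⟩ := Metric.cauchySeq_iff.1 hA (ε / 3 / (t + 1)) (by positivity)
  refine ⟨N, fun m hm n hn => ?_⟩
  have h1 := norm_exp_smul_apply_sub_le (h.commute_yosida m n) (h.norm_exp_yosida_le m)
    (h.norm_exp_yosida_le n) (ι v) ht
  have h2 := hN m hm n hn
  rw [dist_eq_norm, lt_div_iff₀ (by positivity)] at h2
  have h3 := h.norm_exp_yosida_apply_le m ht (x - ι v)
  have h4 := h.norm_exp_yosida_apply_le n ht (x - ι v)
  have e : exp (t • yosida ι L m) x - exp (t • yosida ι L n) x =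
      exp (t • yosida ι L m) (x - ι v) - exp (t • yosida ι L n) (x - ι v) +
        (exp (t • yosida ι L m) (ι v) - exp (t • yosida ι L n) (ι v)) := by
    rw [map_sub, map_sub]; abel
  rw [dist_eq_norm, e]
  have h5 := norm_add_le (exp (t • yosida ι L m) (x - ι v) - exp (t • yosida ι L n) (x - ι v))
    (exp (t • yosida ι L m) (ι v) - exp (t • yosida ι L n) (ι v))
  have h6 := norm_sub_le (exp (t • yosida ι L m) (x - ι v)) (exp (t • yosida ι L n) (x - ι v))
  nlinarith [norm_nonneg (yosida ι L m (ι v) - yosida ι L n (ι v))]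

/-- The limit `lim exp (t Aₙ) x` along the Yosida approximations `Aₙ`. -/
def flow (h : IsMDissipativeCore ι L) (t : ℝ≥0) (x : E) : E :=
  (h.exists_tendsto_exp_yosida t.2 x).choose

theorem tendsto_flow (h : IsMDissipativeCore ι L) (t : ℝ≥0) (x : E) :
    Tendsto (fun n => exp ((t : ℝ) • yosida ι L n) x) atTop (𝓝 (h.flow t x)) :=
  (h.exists_tendsto_exp_yosida t.2 x).choose_spec

theorem norm_flow_le (h : IsMDissipativeCore ι L) (t : ℝ≥0) (x : E) : ‖h.flow t x‖ ≤ ‖x‖ :=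
  le_of_tendsto' (h.tendsto_flow t x).norm fun n => h.norm_exp_yosida_apply_le n t.2 x

/-- The operators `lim exp (t Aₙ)`. -/
def flowOp (h : IsMDissipativeCore ι L) (t : ℝ≥0) : E →L[ℂ] E :=
  LinearMap.mkContinuous
    { toFun := h.flow t
      map_add' := fun x y => tendsto_nhds_unique (h.tendsto_flow t (x + y))
        (((h.tendsto_flow t x).add (h.tendsto_flow t y)).congr fun _ => (map_add _ x y).symm)
      map_smul' := fun c x => tendsto_nhds_unique (h.tendsto_flow t (c • x))
        (((h.tendsto_flow t x).const_smul c).congr fun _ => (map_smul _ c x).symm) }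
    1 fun x => (h.norm_flow_le t x).trans_eq (one_mul _).symm

theorem flowOp_apply (h : IsMDissipativeCore ι L) (t : ℝ≥0) (x : E) :
    h.flowOp t x = h.flow t x := rfl

theorem flowOp_zero (h : IsMDissipativeCore ι L) : h.flowOp 0 = ContinuousLinearMap.id ℂ E := by
  refine ContinuousLinearMap.ext fun x => tendsto_nhds_unique (h.tendsto_flow 0 x) ?_
  simp

theorem flowOp_add (h : IsMDissipativeCore ι L) (s t : ℝ≥0) :
    h.flowOp (s + t) = (h.flowOp s).comp (h.flowOp t) := by
  refine ContinuousLinearMap.ext fun x => tendsto_nhds_unique (h.tendsto_flow (s + t) x) ?_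
  have h1 : Tendsto (fun n => exp ((s : ℝ) • yosida ι L n)
      (exp ((t : ℝ) • yosida ι L n) x - h.flow t x)) atTop (𝓝 0) := by
    refine squeeze_zero_norm (fun n => h.norm_exp_yosida_apply_le n s.2 _) ?_
    have := ((h.tendsto_flow t x).sub_const (h.flow t x)).norm
    rwa [sub_self, norm_zero] at this
  have h2 := h1.add (h.tendsto_flow s (h.flow t x))
  rw [zero_add] at h2
  refine h2.congr fun n => ?_
  rw [← map_add, sub_add_cancel, NNReal.coe_add, exp_add_smul, mul_apply_eq_comp]

theorem norm_flow_sub_le (h : IsMDissipativeCore ι L) (t : ℝ≥0) (v : V) :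
    ‖h.flow t (ι v) - ι v‖ ≤ ‖L v‖ * t := by
  refine le_of_tendsto' ((h.tendsto_flow t (ι v)).sub_const (ι v)).norm fun n => ?_
  have := norm_exp_smul_apply_sub_sub_le (B := yosida ι L n) (x := ι v) (y := 0) (C := ‖L v‖) t.2
    fun s hs _ => by
      rw [sub_zero]
      exact (h.norm_exp_yosida_apply_le n hs _).trans (h.norm_yosida_le n v)
  simpa using this

theorem continuous_flow (h : IsMDissipativeCore ι L) (x : E) : Continuous fun t => h.flow t x := by
  have h1 : ∀ v, ∀ s t : ℝ≥0, s ≤ t → dist (h.flow s (ι v)) (h.flow t (ι v)) ≤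
      ‖L v‖ * dist s t := fun v s t hst => by
    obtain ⟨r, rfl⟩ := exists_add_of_le hst
    have e : h.flow (s + r) (ι v) = h.flowOp s (h.flow r (ι v)) := by
      rw [← flowOp_apply, h.flowOp_add]; rfl
    rw [dist_comm, dist_eq_norm, e, ← flowOp_apply h s (ι v), ← map_sub]
    refine (h.norm_flow_le _ _).trans ((h.norm_flow_sub_le r v).trans_eq ?_)
    rw [NNReal.dist_eq, NNReal.coe_add, sub_add_cancel_left, abs_neg, NNReal.abs_eq]
  have h2 : ∀ v, Continuous fun t => h.flow t (ι v) := fun v => by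
    refine (LipschitzWith.of_dist_le_mul (K := ‖L v‖₊) fun s t => ?_).continuous
    rcases le_total s t with hst | hst
    · exact h1 v s t hst
    · rw [dist_comm, dist_comm s]
      exact h1 v t s hst
  refine continuous_of_uniform_approx_of_continuous fun u hu => ?_
  obtain ⟨ε, hε, hu⟩ := Metric.mem_uniformity_dist.1 hu
  obtain ⟨v, hv⟩ := h.dense.exists_dist_lt x hε
  refine ⟨fun t => h.flow t (ι v), h2 v, fun t => hu ?_⟩
  dsimp only
  rw [dist_eq_norm, ← flowOp_apply, ← flowOp_apply, ← map_sub]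
  refine (h.norm_flow_le _ _).trans_lt ?_
  rwa [← dist_eq_norm]

/-- The contraction semigroup generated by an m-dissipative operator. -/
def semigroup (h : IsMDissipativeCore ι L) : C0Semigroup E where
  op := h.flowOp
  op_zero := h.flowOp_zero
  op_add := h.flowOp_add
  continuous_orbit := h.continuous_flow

theorem norm_semigroup_apply_le (h : IsMDissipativeCore ι L) (t : ℝ≥0) (x : E) :
    ‖h.semigroup.op t x‖ ≤ ‖x‖ := h.norm_flow_le t x

theorem hasDerivAtZero_semigroup (h : IsMDissipativeCore ι L) (v : V) :
    h.semigroup.HasDerivAtZero (ι v) (L v) := by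
  refine C0Semigroup.hasDerivAtZero_of_norm_sub_sub_le fun ε hε => ?_
  have hc : Tendsto (fun s => ‖h.flow s (L v) - L v‖) (𝓝 0) (𝓝 ‖h.flow 0 (L v) - L v‖) :=
    (((h.continuous_flow (L v)).sub continuous_const).norm).tendsto 0
  obtain ⟨w, hw⟩ := h.dense.exists_dist_lt (L v) (show 0 < ε / 4 by positivity)
  rw [dist_eq_norm] at hw
  have h0 : ∀ᶠ t : ℝ≥0 in 𝓝 0, ‖L w‖ * t < ε / 4 := by
    have h1 : Tendsto (fun t : ℝ≥0 => ‖L w‖ * (t : ℝ)) (𝓝 0) (𝓝 (‖L w‖ * ((0 : ℝ≥0) : ℝ))) :=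
      (continuous_const.mul NNReal.continuous_coe).tendsto 0
    rw [NNReal.coe_zero, mul_zero] at h1
    exact h1.eventually (gt_mem_nhds (by positivity))
  filter_upwards [h0] with t ht
  refine le_of_tendsto
    (((h.tendsto_flow t (ι v)).sub_const (ι v)).sub_const ((t : ℝ) • L v)).norm ?_
  have h2 := ((h.tendsto_yosida v).sub_const (L v)).norm
  rw [sub_self, norm_zero] at h2
  filter_upwards [h2.eventually (gt_mem_nhds (show 0 < ε / 4 by positivity))] with n hn
  refine norm_exp_smul_apply_sub_sub_le t.2 fun s hs hst => ?_
  set S := exp (s • yosida ι L n)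
  have e : S (yosida ι L n (ι v)) - L v = S (yosida ι L n (ι v) - L v) + S (L v - ι w) +
      (S (ι w) - ι w) - (L v - ι w) := by
    simp only [map_sub]; abel
  have h3 : ‖S (ι w) - ι w‖ ≤ ‖L w‖ * s := by
    have := norm_exp_smul_apply_sub_sub_le (B := yosida ι L n) (x := ι w) (y := 0) (C := ‖L w‖) hs
      fun r hr _ => by
        rw [sub_zero]
        exact (h.norm_exp_yosida_apply_le n hr _).trans (h.norm_yosida_le n w)
    simpa using this
  have h4 : ‖L w‖ * s ≤ ‖L w‖ * t := mul_le_mul_of_nonneg_left hst (norm_nonneg _)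
  have h5 : ‖S (yosida ι L n (ι v) - L v)‖ ≤ _ := h.norm_exp_yosida_apply_le n hs _
  have h6 : ‖S (L v - ι w)‖ ≤ _ := h.norm_exp_yosida_apply_le n hs _
  rw [e]
  linarith [norm_sub_le (S (yosida ι L n (ι v) - L v) + S (L v - ι w) + (S (ι w) - ι w))
    (L v - ι w), norm_add_le (S (yosida ι L n (ι v) - L v) + S (L v - ι w)) (S (ι w) - ι w),
    norm_add_le (S (yosida ι L n (ι v) - L v)) (S (L v - ι w))]

theorem semigroup_resolvent (h : IsMDissipativeCore ι L) {z : ℂ} (hz : 0 < z.re) (t : ℝ≥0)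
    (x : E) : h.semigroup.op t (coreResolvent ι L z x) =
      coreResolvent ι L z (h.semigroup.op t x) := by
  let _ := NormedAlgebra.restrictScalars ℚ ℝ (E →L[ℂ] E)
  refine tendsto_nhds_unique (h.tendsto_flow t _)
    ((((coreResolvent ι L z).continuous.tendsto _).comp (h.tendsto_flow t x)).congr fun n => ?_)
  have h1 : Commute (coreResolvent ι L z) (exp ((t : ℝ) • yosida ι L n)) :=
    ((h.commute_yosida_resolvent n hz).symm.smul_right _).exp_right
  exact DFunLike.congr_fun h1.eq x

/-- The open right half-plane is contained in the resolvent set of the generator. -/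
theorem mem_unboundedResolventSet (h : IsMDissipativeCore ι L) {z : ℂ} (hz : 0 < z.re) :
    z ∈ unboundedResolventSet h.semigroup.generator := by
  have hG : ∀ x, h.semigroup.HasDerivAtZero (coreResolvent ι L z x)
      (z • coreResolvent ι L z x - x) := fun x =>
    h.mem_of_isClosed h.semigroup.isClosed_hasDerivAtZero h.hasDerivAtZero_semigroup hz x
  refine ⟨-coreResolvent ι L z, fun x => ?_, fun x => ?_⟩
  · have h1 := hG (-x)
    rw [map_neg, ← neg_apply] at h1
    obtain ⟨hx, h2⟩ := h1.exists_generator_eq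
    exact ⟨hx, by rw [h2]; abel⟩
  · have h1 := h.semigroup.generator_spec x
    have h2 : h.semigroup.HasDerivAtZero (coreResolvent ι L z x)
        (coreResolvent ι L z (h.semigroup.generator x)) := by
      refine (((coreResolvent ι L z).continuous.tendsto _).comp h1).congr fun t => ?_
      rw [Function.comp_apply, map_smul, map_sub, h.semigroup_resolvent hz]
    have h3 := h2.unique (hG x)
    rw [neg_apply, map_sub, h3, map_smul]
    abel

/-- On the range of the square of the resolvent, the orbits of every semigroup whose generator
extends `L` agree with their first-order Taylor polynomial up to a quadratic error. -/
theorem norm_op_sub_taylor_le (h : IsMDissipativeCore ι L) {Ψ : C0Semigroup E}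
    (hΨ : ∀ v, Ψ.HasDerivAtZero (ι v) (L v)) {T : ℝ≥0} {K : ℝ} (hK0 : 0 ≤ K)
    (hK : ∀ s ≤ T, ∀ x, ‖Ψ.op s x‖ ≤ K * ‖x‖) (x : E) {t : ℝ≥0} (ht : t ≤ T) :
    ‖Ψ.op t (coreResolvent ι L 1 (coreResolvent ι L 1 x)) -
      coreResolvent ι L 1 (coreResolvent ι L 1 x) -
      (t : ℝ) • coreResolvent ι L 1 (coreResolvent ι L 1 x - x)‖ ≤
        (K + 2) * (4 * ‖x‖) * t * t := by
  set R := coreResolvent ι L 1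
  have h1re : 0 < (1 : ℂ).re := by simp
  have hR : ∀ x, ‖R x‖ ≤ ‖x‖ := fun x => by
    simpa using h.norm_resolvent_apply_le h1re x
  have hG : ∀ x, Ψ.HasDerivAtZero (R x) (R x - x) := fun x => by
    have h2 := h.mem_of_isClosed Ψ.isClosed_hasDerivAtZero hΨ h1re x
    rwa [one_smul] at h2
  have hy : ‖R (R x - x) - (R x - x)‖ ≤ 4 * ‖x‖ := by
    linarith [norm_sub_le (R (R x - x)) (R x - x), hR (R x - x), norm_sub_le (R x) x, hR x]
  have h2 : ∀ s ≤ t, ‖Ψ.op s (R (R x - x)) - R (R x - x)‖ ≤ (K + 2) * (4 * ‖x‖) * t := by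
    intro s hs
    set y' := R (R x - x) - (R x - x) with hy'
    have h3 := (hG (R x - x)).norm_sub_sub_le (t := s) (C := (K + 1) * ‖y'‖) fun r hr => by
      have h4 := hK r (hr.trans (hs.trans ht)) y'
      linarith [norm_sub_le (Ψ.op r y') y']
    rw [← hy'] at h3
    have h5 := norm_add_le (Ψ.op s (R (R x - x)) - R (R x - x) - (s : ℝ) • y') ((s : ℝ) • y')
    rw [sub_add_cancel, norm_smul, NNReal.norm_eq] at h5
    have hst : (s : ℝ) ≤ t := hs
    calc _ ≤ (K + 1) * ‖y'‖ * s + s * ‖y'‖ := by linarith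
      _ = (K + 2) * ‖y'‖ * s := by ring
      _ ≤ (K + 2) * (4 * ‖x‖) * t := by gcongr
  have h6 : Ψ.HasDerivAtZero (R (R x)) (R (R x - x)) := by
    have := hG (R x)
    rwa [← map_sub] at this
  exact h6.norm_sub_sub_le h2

/-- A semigroup whose generator extends `L` is the one generated by `L`. -/
theorem eq_semigroup (h : IsMDissipativeCore ι L) {Ψ : C0Semigroup E}
    (hΨ : ∀ v, Ψ.HasDerivAtZero (ι v) (L v)) : Ψ = h.semigroup := by
  refine C0Semigroup.ext_op fun T x => ?_
  set Φ := h.semigroup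
  set R := coreResolvent ι L 1
  have h1re : 0 < (1 : ℂ).re := by simp
  obtain ⟨K, hK0, hK⟩ := Ψ.exists_bound T
  have hdense : DenseRange fun x => R (R x) :=
    (h.denseRange_resolvent h1re).comp (h.denseRange_resolvent h1re) R.continuous
  refine hdense.induction_on (p := fun x => Ψ.op T x = Φ.op T x) x
    (isClosed_eq (by fun_prop) (by fun_prop)) fun z => ?_
  set M := ((K + 2) + (1 + 2)) * 4
  have hloc : ∀ t ≤ T, ∀ z, ‖Ψ.op t (R (R z)) - Φ.op t (R (R z))‖ ≤ M * ‖z‖ * t * t := by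
    intro t ht z
    have h1 := h.norm_op_sub_taylor_le hΨ hK0 hK z ht
    have h2 := h.norm_op_sub_taylor_le h.hasDerivAtZero_semigroup (T := T) zero_le_one
      (fun s _ x => by rw [one_mul]; exact h.norm_semigroup_apply_le s x) z ht
    have h3 := norm_sub_le (Ψ.op t (R (R z)) - R (R z) - (t : ℝ) • R (R z - z))
      (Φ.op t (R (R z)) - R (R z) - (t : ℝ) • R (R z - z))
    rw [sub_sub_sub_cancel_right, sub_sub_sub_cancel_right] at h3
    calc _ ≤ _ := h3
      _ ≤ _ := add_le_add h1 h2
      _ = _ := by simp only [M]; ring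
  -- Telescope `Ψ_{kt} - Φ_{kt}` into `k` steps of length `t`.
  have hstep : ∀ t : ℝ≥0, ∀ k : ℕ, k * t ≤ T → ∀ z,
      ‖Ψ.op (k * t) (R (R z)) - Φ.op (k * t) (R (R z))‖ ≤ k * (K * (M * t * t)) * ‖z‖ := by
    intro t k
    induction k with
    | zero => intro _ z; simp [Ψ.op_zero, Φ.op_zero]
    | succ k ih =>
      intro hk z
      have e : ((k + 1 : ℕ) : ℝ≥0) * t = k * t + t := by push_cast; ring
      rw [e] at hk ⊢
      have hk1 : k * t ≤ T := le_self_add.trans hk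
      have hk2 : t ≤ T := le_add_self.trans hk
      rw [Ψ.op_add, Φ.op_add, ContinuousLinearMap.comp_apply, ContinuousLinearMap.comp_apply]
      have e2 : Φ.op t (R (R z)) = R (R (Φ.op t z)) := by
        rw [h.semigroup_resolvent h1re, h.semigroup_resolvent h1re]
      have e3 : Ψ.op (k * t) (Ψ.op t (R (R z))) - Φ.op (k * t) (Φ.op t (R (R z))) =
          Ψ.op (k * t) (Ψ.op t (R (R z)) - Φ.op t (R (R z))) +
          (Ψ.op (k * t) (R (R (Φ.op t z))) - Φ.op (k * t) (R (R (Φ.op t z)))) := by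
        rw [map_sub, e2]; abel
      rw [e3]
      have h1 := hK _ hk1 (Ψ.op t (R (R z)) - Φ.op t (R (R z)))
      have h2 := mul_le_mul_of_nonneg_left (hloc t hk2 z) hK0
      have h3 := ih hk1 (Φ.op t z)
      have h4 : (k : ℝ) * (K * (M * t * t)) * ‖Φ.op t z‖ ≤ k * (K * (M * t * t)) * ‖z‖ :=
        mul_le_mul_of_nonneg_left (h.norm_semigroup_apply_le t z) (by positivity)
      refine (norm_add_le _ _).trans ?_
      push_cast
      linarith
  have hlim : ∀ n : ℕ, ‖Ψ.op T (R (R z)) - Φ.op T (R (R z))‖ ≤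
      K * M * T * T * ‖z‖ * (1 / ((n : ℝ) + 1)) := fun n => by
    have e : ((n + 1 : ℕ) : ℝ≥0) * (T / (n + 1 : ℕ)) = T :=
      mul_div_cancel₀ _ (by positivity)
    have h1 := hstep (T / (n + 1 : ℕ)) (n + 1) e.le z
    rw [e] at h1
    refine h1.trans_eq ?_
    push_cast
    have : (n : ℝ) + 1 ≠ 0 := by positivity
    field_simp
  have h2 : Tendsto (fun n : ℕ => K * M * T * T * ‖z‖ * (1 / ((n : ℝ) + 1))) atTop
      (𝓝 (K * M * T * T * ‖z‖ * 0)) := tendsto_one_div_add_atTop_nhds_zero_nat.const_mul _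
  rw [mul_zero] at h2
  have h3 := ge_of_tendsto' h2 hlim
  exact sub_eq_zero.1 (norm_le_zero_iff.1 h3)

end IsMDissipativeCore

end LumerPhillips

/-! ### Dissipativity of Lindblad operators for the trace norm -/

noncomputable section Dissipativity

set_option linter.unusedSectionVars false

variable {𝓗 : Type*} [NormedAddCommGroup 𝓗] [InnerProductSpace ℂ 𝓗] [CompleteSpace 𝓗]

/-- The trace of the compression to the first `M` basis vectors. -/
def levelTrace (b : HilbertBasis ℕ ℂ 𝓗) (M : ℕ) : (𝓗 →L[ℂ] 𝓗) →ₗ[ℂ] ℂ where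
  toFun X := ∑ n ∈ Finset.range M, ⟪b n, X (b n)⟫_ℂ
  map_add' X Y := by simp only [add_apply, inner_add_right, Finset.sum_add_distrib]
  map_smul' c X := by simp [smul_apply, Finset.mul_sum]

theorem levelTrace_apply (b : HilbertBasis ℕ ℂ 𝓗) (M : ℕ) (X : 𝓗 →L[ℂ] 𝓗) :
    levelTrace b M X = ∑ n ∈ Finset.range M, ⟪b n, X (b n)⟫_ℂ := rfl

theorem levelTrace_mul_levelProj_mul (b : HilbertBasis ℕ ℂ 𝓗) (M : ℕ) (X Y : 𝓗 →L[ℂ] 𝓗) :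
    levelTrace b M (X * levelProj b M * Y) = ∑ n ∈ Finset.range M, ∑ m ∈ Finset.range M,
      ⟪b n, X (b m)⟫_ℂ * ⟪b m, Y (b n)⟫_ℂ := by
  rw [levelTrace_apply]
  refine Finset.sum_congr rfl fun n _ => ?_
  simp only [mul_apply_eq_comp, levelProj, sum_apply, InnerProductSpace.rankOne_apply, map_sum,
    map_smul, inner_sum, inner_smul_right]
  exact Finset.sum_congr rfl fun m _ => mul_comm _ _

theorem levelTrace_mul_comm (b : HilbertBasis ℕ ℂ 𝓗) {M : ℕ} {X : 𝓗 →L[ℂ] 𝓗} (Y : 𝓗 →L[ℂ] 𝓗)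
    (h1 : levelProj b M * X = X) (h2 : X * levelProj b M = X) :
    levelTrace b M (X * Y) = levelTrace b M (Y * X) := by
  conv_lhs => rw [← h2]
  conv_rhs => rw [← h1, ← mul_assoc]
  rw [levelTrace_mul_levelProj_mul, levelTrace_mul_levelProj_mul, Finset.sum_comm]
  exact Finset.sum_congr rfl fun n _ => Finset.sum_congr rfl fun m _ => mul_comm _ _

theorem levelTrace_star_mul (b : HilbertBasis ℕ ℂ 𝓗) (M : ℕ) (X Y : 𝓗 →L[ℂ] 𝓗) :
    levelTrace b M (star X * Y) = ∑ n ∈ Finset.range M, ⟪X (b n), Y (b n)⟫_ℂ := by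
  rw [levelTrace_apply]
  refine Finset.sum_congr rfl fun n _ => ?_
  rw [mul_apply_eq_comp, ContinuousLinearMap.star_eq_adjoint,
    ContinuousLinearMap.adjoint_inner_right]

theorem levelTrace_star_mul_self (b : HilbertBasis ℕ ℂ 𝓗) (M : ℕ) (X : 𝓗 →L[ℂ] 𝓗) :
    levelTrace b M (star X * X) = ((∑ n ∈ Finset.range M, ‖X (b n)‖ ^ 2 : ℝ) : ℂ) := by
  rw [levelTrace_star_mul]
  push_cast
  exact Finset.sum_congr rfl fun n _ => inner_self_eq_norm_sq_to_K _

/-- The Lindblad dissipator `x ↦ V x V† - ½ {V† V, x}`. -/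
def dissipator (V : 𝓗 →L[ℂ] 𝓗) : (𝓗 →L[ℂ] 𝓗) →ₗ[ℂ] (𝓗 →L[ℂ] 𝓗) where
  toFun x := V * x * star V - (1 / 2 : ℂ) • (star V * V * x + x * (star V * V))
  map_add' x y := by simp only [mul_add, add_mul, smul_add]; abel
  map_smul' c x := by
    simp only [mul_smul_comm, smul_mul_assoc, RingHom.id_apply, smul_sub, smul_add, smul_smul,
      mul_comm c]

theorem dissipator_apply (V x : 𝓗 →L[ℂ] 𝓗) : dissipator V x =
    V * x * star V - (1 / 2 : ℂ) • (star V * V * x + x * (star V * V)) := rfl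

/-- Dissipativity of `x ↦ V x V† - ½ {V† V, x}` at `x = U R²`, where `R ≥ 0` and `U† U R² = R²`. The
three traces are `⟨U V R, V U R⟩`, `‖V U R‖²` and `‖V R‖²` in the Hilbert-Schmidt inner product. -/
theorem re_levelTrace_dissipator_nonpos (b : HilbertBasis ℕ ℂ 𝓗) {M : ℕ} {U R V : 𝓗 →L[ℂ] 𝓗}
    (hU : ‖U‖ ≤ 1) (hR : star R = R) (hER : levelProj b M * R = R) (hRE : R * levelProj b M = R)
    (hEV : levelProj b M * V = V) (hUR : star U * (U * (R * R)) = R * R) :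
    (levelTrace b M (star U * dissipator V (U * (R * R)))).re ≤ 0 := by
  have hVE : star V * levelProj b M = star V := by
    rw [← star_levelProj b M, ← star_mul, hEV]
  have e1 : levelTrace b M (star U * (V * (U * (R * R)) * star V)) =
      ∑ n ∈ Finset.range M, ⟪(U * V * R) (b n), (V * U * R) (b n)⟫_ℂ := by
    rw [← levelTrace_star_mul]
    have h1 := levelTrace_mul_comm b (X := R * star V) (star U * V * U * R)
      (by rw [← mul_assoc, hER]) (by rw [mul_assoc, hVE])
    calc _ = levelTrace b M (star U * V * U * R * (R * star V)) := by simp only [mul_assoc]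
      _ = levelTrace b M (R * star V * (star U * V * U * R)) := h1.symm
      _ = _ := by simp only [star_mul, hR, mul_assoc]
  have e2 : levelTrace b M (star U * (star V * V * (U * (R * R)))) =
      ((∑ n ∈ Finset.range M, ‖(V * U * R) (b n)‖ ^ 2 : ℝ) : ℂ) := by
    rw [← levelTrace_star_mul_self]
    have h1 := levelTrace_mul_comm b (star U * star V * V * U * R) hER hRE
    calc _ = levelTrace b M (star U * star V * V * U * R * R) := by simp only [mul_assoc]
      _ = levelTrace b M (R * (star U * star V * V * U * R)) := h1.symm
      _ = _ := by simp only [star_mul, hR, mul_assoc]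
  have e3 : levelTrace b M (star U * (U * (R * R) * (star V * V))) =
      ((∑ n ∈ Finset.range M, ‖(V * R) (b n)‖ ^ 2 : ℝ) : ℂ) := by
    rw [← levelTrace_star_mul_self]
    have h1 := levelTrace_mul_comm b (R * star V * V) hER hRE
    calc _ = levelTrace b M (star U * (U * (R * R)) * (star V * V)) := by simp only [mul_assoc]
      _ = levelTrace b M (R * (R * star V * V)) := by rw [hUR]; simp only [mul_assoc]
      _ = levelTrace b M (R * star V * V * R) := h1
      _ = _ := by simp only [star_mul, hR, mul_assoc]
  have h4 : (∑ n ∈ Finset.range M, ⟪(U * V * R) (b n), (V * U * R) (b n)⟫_ℂ).re ≤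
      ∑ n ∈ Finset.range M, (‖(V * U * R) (b n)‖ ^ 2 + ‖(V * R) (b n)‖ ^ 2) / 2 := by
    rw [Complex.re_sum]
    refine Finset.sum_le_sum fun n _ => ?_
    have h5 : ‖(U * V * R) (b n)‖ ≤ ‖(V * R) (b n)‖ := by
      rw [mul_assoc]
      exact (U.le_of_opNorm_le hU _).trans_eq (one_mul _)
    have h6 : (⟪(U * V * R) (b n), (V * U * R) (b n)⟫_ℂ).re ≤ _ := re_inner_le_norm (𝕜 := ℂ) _ _
    nlinarith [sq_nonneg (‖(V * U * R) (b n)‖ - ‖(V * R) (b n)‖),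
      norm_nonneg ((V * U * R) (b n))]
  rw [dissipator_apply, mul_sub, mul_smul_comm, mul_add, map_sub, map_smul, map_add, e1, e2, e3]
  have h7 : ((1 / 2 : ℂ) • (((∑ n ∈ Finset.range M, ‖(V * U * R) (b n)‖ ^ 2 : ℝ) : ℂ) +
      ((∑ n ∈ Finset.range M, ‖(V * R) (b n)‖ ^ 2 : ℝ) : ℂ))).re =
      ∑ n ∈ Finset.range M, (‖(V * U * R) (b n)‖ ^ 2 + ‖(V * R) (b n)‖ ^ 2) / 2 := by
    rw [← Complex.ofReal_add, ← Finset.sum_add_distrib, smul_eq_mul, ← Finset.sum_div]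
    rw [show (1 / 2 : ℂ) = ((1 / 2 : ℝ) : ℂ) by norm_num, ← Complex.ofReal_mul, Complex.ofReal_re]
    ring
  rw [Complex.sub_re, h7]
  linarith

theorem sqrt_abs_mul_levelProj {b : HilbertBasis ℕ ℂ 𝓗} {M : ℕ} {T : 𝓗 →L[ℂ] 𝓗}
    (hT : T * levelProj b M = T) :
    CFC.sqrt (CFC.abs T) * levelProj b M = CFC.sqrt (CFC.abs T) := by
  have hR0 : star (CFC.sqrt (CFC.abs T)) = CFC.sqrt (CFC.abs T) :=
    (CFC.sqrt_nonneg _).isSelfAdjoint.star_eq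
  have hRR : CFC.sqrt (CFC.abs T) * CFC.sqrt (CFC.abs T) = CFC.abs T :=
    CFC.sqrt_mul_sqrt_self _ (CFC.abs_nonneg T)
  refine ContinuousLinearMap.ext fun x => ?_
  rw [← sub_eq_zero, mul_apply_eq_comp, ← map_sub]
  set y := levelProj b M x - x
  have hTy : T y = 0 := by
    rw [map_sub, ← mul_apply_eq_comp, hT, sub_self]
  have hP : CFC.abs T y = 0 := by rw [← norm_eq_zero, norm_abs_apply, hTy, norm_zero]
  rw [← inner_self_eq_zero (𝕜 := ℂ)]
  conv_lhs => rw [← ContinuousLinearMap.adjoint_inner_right,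
    ← ContinuousLinearMap.star_eq_adjoint, hR0, ← mul_apply_eq_comp, hRR, hP]
  exact inner_zero_right _

theorem sum_re_inner_le_norm {b : HilbertBasis ℕ ℂ 𝓗} (T : TraceClass b) {U : 𝓗 →L[ℂ] 𝓗}
    (hU : ‖U‖ ≤ 1) (s : Finset ℕ) :
    ∑ n ∈ s, RCLike.re ⟪U (b n), T.toOp (b n)⟫_ℂ ≤ ‖T‖ := by
  have h1 := ENNReal.toReal_mono (ne_of_lt T.2) (sum_re_inner_le_eTraceNorm b U T.toOp hU s)
  rw [ENNReal.toReal_sum fun _ _ => ENNReal.ofReal_ne_top] at h1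
  refine le_trans (Finset.sum_le_sum fun n _ => ?_) h1
  rw [ENNReal.toReal_ofReal']
  exact le_max_left _ _

/-- Dissipativity for the trace norm, on operators supported on finitely many levels, of positive
combinations of two Lindblad dissipators. -/
theorem re_mul_norm_le_norm_smul_sub_of_dissipator {b : HilbertBasis ℕ ℂ 𝓗} {M : ℕ}
    {V W : 𝓗 →L[ℂ] 𝓗} (hV : levelProj b M * V = V) (hW : levelProj b M * W = W)
    {p q : ℝ} (hp : 0 ≤ p) (hq : 0 ≤ q) {x y : TraceClass b}
    (hx : x.toOp * levelProj b M = x.toOp)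
    (hy : y.toOp = (p : ℂ) • dissipator V x.toOp + (q : ℂ) • dissipator W x.toOp) {z : ℂ} :
    z.re * ‖x‖ ≤ ‖z • x - y‖ := by
  obtain ⟨U, hU, hU1, hU2⟩ := exists_polar x.toOp
  set R := CFC.sqrt (CFC.abs x.toOp) with hRdef
  have hR : star R = R := (CFC.sqrt_nonneg _).isSelfAdjoint.star_eq
  have hRR : R * R = CFC.abs x.toOp := CFC.sqrt_mul_sqrt_self _ (CFC.abs_nonneg _)
  have hRE : R * levelProj b M = R := sqrt_abs_mul_levelProj hx
  have hER : levelProj b M * R = R := by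
    conv_rhs => rw [← hR, ← hRE, star_mul, hR, star_levelProj]
  have hxU : x.toOp = U * (R * R) := by rw [hRR, hU1]
  have hUR : star U * (U * (R * R)) = R * R := by rw [← hxU, hU2, hRR]
  have h0 : ∀ n, M ≤ n → R (b n) = 0 := fun n hn => by
    rw [← hRE, mul_apply_eq_comp, levelProj_apply_basis, if_neg (Nat.not_lt.2 hn), map_zero]
  have hnorm : ‖x‖ = ∑ n ∈ Finset.range M, ‖R (b n)‖ ^ 2 := by
    rw [TraceClass.norm_def, eTraceNorm_eq, eHilbertSchmidtSq, ← hRdef,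
      tsum_eq_sum (s := Finset.range M), ENNReal.toReal_sum fun _ _ => ENNReal.ofReal_ne_top]
    · exact Finset.sum_congr rfl fun n _ => ENNReal.toReal_ofReal (by positivity)
    · intro n hn
      rw [h0 n (Nat.not_lt.1 fun h => hn (Finset.mem_range.2 h)), norm_zero,
        zero_pow two_ne_zero, ENNReal.ofReal_zero]
  have htr : levelTrace b M (star U * x.toOp) = ((‖x‖ : ℝ) : ℂ) := by
    rw [hU2, ← hRR, hnorm, ← levelTrace_star_mul_self, hR]
  have h1 : (levelTrace b M (star U * (z • x - y).toOp)).re ≤ ‖z • x - y‖ := by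
    rw [levelTrace_star_mul, Complex.re_sum]
    exact sum_re_inner_le_norm _ hU _
  refine le_trans ?_ h1
  have hVn := re_levelTrace_dissipator_nonpos b hU hR hER hRE hV hUR
  have hWn := re_levelTrace_dissipator_nonpos b hU hR hER hRE hW hUR
  rw [← hxU] at hVn hWn
  rw [map_sub, map_smul, mul_sub, mul_smul_comm, map_sub, map_smul, htr, hy, mul_add,
    mul_smul_comm, mul_smul_comm, map_add, map_smul, map_smul, Complex.sub_re, smul_eq_mul,
    Complex.re_mul_ofReal, Complex.add_re, smul_eq_mul, smul_eq_mul, Complex.re_ofReal_mul,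
    Complex.re_ofReal_mul]
  nlinarith

end Dissipativity

/-! ### The quantum Ornstein-Uhlenbeck operator on finite combinations of matrix units -/

noncomputable section OrnsteinUhlenbeck

/-- By the Hahn-Banach theorem, a linear map has dense range if no nonzero continuous functional
vanishes on its range. -/
theorem denseRange_of_forall_dual_eq_zero {V E : Type*} [AddCommGroup V] [Module ℂ V]
    [NormedAddCommGroup E] [NormedSpace ℂ E] (g : V →ₗ[ℂ] E)
    (h : ∀ φ : E →L[ℂ] ℂ, (∀ v, φ (g v) = 0) → φ = 0) : DenseRange g := by
  let K := (LinearMap.range g).topologicalClosure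
  have hK : IsClosed (K : Set E) := Submodule.isClosed_topologicalClosure _
  intro x
  by_contra hx
  have hxK : x ∉ K := hx
  have hne : ‖K.mkQL x‖ ≠ 0 := by
    rw [norm_ne_zero_iff]
    exact fun h0 => hxK ((Submodule.Quotient.mk_eq_zero K).1 h0)
  obtain ⟨ψ, -, hψ⟩ := exists_dual_vector ℂ (K.mkQL x) hne
  have h0 : ψ.comp K.mkQL = 0 := h _ fun v => by
    have : K.mkQL (g v) = 0 := (Submodule.Quotient.mk_eq_zero K).2
      (Submodule.le_topologicalClosure _ ⟨v, rfl⟩)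
    rw [ContinuousLinearMap.comp_apply, this, map_zero]
  have h1 := DFunLike.congr_fun h0 x
  rw [ContinuousLinearMap.comp_apply, hψ] at h1
  exact hne (by simpa using h1)

/-- Bounded solutions of a three-term recursion with diagonal `z + sₖ`, where `Re z > 0`,
`sₖ ≥ cₖ + dₖ` and `∑ 1 / cₖ = ∞`, vanish: moduli of solutions increase at least by the factors
`1 + Re z / cₖ`. -/
theorem eq_zero_of_three_term_recursion {X : ℕ → ℂ} {c d s : ℕ → ℝ} {z : ℂ} (hz : 0 < z.re)
    (hc : ∀ k, 0 < c k) (hd : ∀ k, 0 ≤ d k) (hs : ∀ k, c k + d k ≤ s k)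
    (h0 : (c 0 : ℂ) * X 1 = (z + s 0) * X 0)
    (h1 : ∀ k, (c (k + 1) : ℂ) * X (k + 2) = (z + s (k + 1)) * X (k + 1) - d (k + 1) * X k)
    (hsum : ¬ Summable fun k => (c k)⁻¹) {C : ℝ} (hX : ∀ k, ‖X k‖ ≤ C) (k : ℕ) : X k = 0 := by
  have hnorm : ∀ k, z.re + s k ≤ ‖z + s k‖ := fun k => by
    have := Complex.re_le_norm (z + s k)
    simpa using this
  -- Growth of the solution.
  have hgrow : ∀ k, (c k + z.re) * ‖X k‖ ≤ c k * ‖X (k + 1)‖ := by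
    intro k
    induction k with
    | zero =>
      have h2 := congrArg norm h0
      rw [norm_mul, norm_mul, Complex.norm_real, Real.norm_of_nonneg (hc 0).le] at h2
      rw [h2]
      exact mul_le_mul_of_nonneg_right (by linarith [hnorm 0, hs 0, hd 0]) (norm_nonneg _)
    | succ k ih =>
      have hmono : ‖X k‖ ≤ ‖X (k + 1)‖ := by
        have h3 : c k * ‖X k‖ ≤ c k * ‖X (k + 1)‖ := by
          nlinarith [mul_nonneg hz.le (norm_nonneg (X k))]
        exact le_of_mul_le_mul_left h3 (hc k)
      have h2 := congrArg norm (h1 k)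
      rw [norm_mul, Complex.norm_real, Real.norm_of_nonneg (hc (k + 1)).le] at h2
      rw [h2]
      have h3 := norm_sub_norm_le ((z + s (k + 1)) * X (k + 1)) (d (k + 1) * X k)
      rw [norm_mul, norm_mul, Complex.norm_real, Real.norm_of_nonneg (hd (k + 1))] at h3
      have h4 := mul_le_mul_of_nonneg_left hmono (hd (k + 1))
      have h5 : (z.re + s (k + 1)) * ‖X (k + 1)‖ ≤ ‖z + s (k + 1)‖ * ‖X (k + 1)‖ :=
        mul_le_mul_of_nonneg_right (hnorm _) (norm_nonneg _)
      have h6 : (c (k + 1) + d (k + 1)) * ‖X (k + 1)‖ ≤ s (k + 1) * ‖X (k + 1)‖ :=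
        mul_le_mul_of_nonneg_right (hs _) (norm_nonneg _)
      nlinarith
  have hstep : ∀ k, ‖X k‖ + z.re * (c k)⁻¹ * ‖X k‖ ≤ ‖X (k + 1)‖ := fun k => by
    have h2 : c k * (c k)⁻¹ = 1 := mul_inv_cancel₀ (hc k).ne'
    refine le_of_mul_le_mul_left ?_ (hc k)
    calc c k * (‖X k‖ + z.re * (c k)⁻¹ * ‖X k‖) = (c k + z.re * (c k * (c k)⁻¹)) * ‖X k‖ := by ring
      _ ≤ _ := by rw [h2, mul_one]; exact hgrow k
  have hpos : ∀ k, 0 ≤ z.re * (c k)⁻¹ := fun k => mul_nonneg hz.le (inv_nonneg.2 (hc k).le)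
  have hX0 : X 0 = 0 := by
    by_contra hne
    have hn0 : 0 < ‖X 0‖ := norm_pos_iff.2 hne
    have hge : ∀ k, ‖X 0‖ ≤ ‖X k‖ := by
      intro k
      induction k with
      | zero => exact le_rfl
      | succ k ih => nlinarith [hstep k, mul_nonneg (hpos k) (norm_nonneg (X k))]
    have hlow : ∀ n, z.re * ‖X 0‖ * ∑ k ∈ Finset.range n, (c k)⁻¹ ≤ ‖X n‖ := by
      intro n
      induction n with
      | zero => simp
      | succ n ih =>
        rw [Finset.sum_range_succ, mul_add]
        have h2 := mul_le_mul_of_nonneg_left (hge n) (hpos n)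
        nlinarith [hstep n]
    refine hsum (summable_of_sum_range_le (c := C / (z.re * ‖X 0‖))
      (fun k => inv_nonneg.2 (hc k).le) fun n => ?_)
    rw [le_div_iff₀ (mul_pos hz hn0), mul_comm]
    exact (hlow n).trans (hX n)
  have hall : ∀ k, X k = 0 ∧ X (k + 1) = 0 := by
    intro k
    induction k with
    | zero =>
      refine ⟨hX0, ?_⟩
      rw [hX0, mul_zero] at h0
      exact (mul_eq_zero.1 h0).resolve_left (Complex.ofReal_ne_zero.2 (hc 0).ne')
    | succ k ih =>
      refine ⟨ih.2, ?_⟩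
      have h2 := h1 k
      rw [ih.1, ih.2, mul_zero, mul_zero, sub_zero] at h2
      exact (mul_eq_zero.1 h2).resolve_left (Complex.ofReal_ne_zero.2 (hc (k + 1)).ne')
  exact (hall k).1

theorem not_summable_inv_mul_sqrt_mul_sqrt {p : ℝ} (hp : 0 < p) (i j : ℕ) :
    ¬ Summable fun k : ℕ =>
      (p * (Real.sqrt ((i + k : ℕ) + 1) * Real.sqrt ((j + k : ℕ) + 1)))⁻¹ := by
  intro h
  have h1 : Summable fun k : ℕ => p⁻¹ * ((k + (i + j + 1) : ℕ) : ℝ)⁻¹ := by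
    refine Summable.of_nonneg_of_le (fun k => by positivity) (fun k => ?_) h
    rw [← mul_inv]
    refine inv_anti₀ (by positivity) (mul_le_mul_of_nonneg_left ?_ hp.le)
    have ha : Real.sqrt ((i + k : ℕ) + 1) ≤ Real.sqrt ((k + (i + j + 1) : ℕ)) :=
      Real.sqrt_le_sqrt (by push_cast; linarith [(Nat.cast_nonneg j : (0 : ℝ) ≤ j)])
    have hb : Real.sqrt ((j + k : ℕ) + 1) ≤ Real.sqrt ((k + (i + j + 1) : ℕ)) :=
      Real.sqrt_le_sqrt (by push_cast; linarith [(Nat.cast_nonneg i : (0 : ℝ) ≤ i)])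
    calc _ ≤ Real.sqrt ((k + (i + j + 1) : ℕ)) * Real.sqrt ((k + (i + j + 1) : ℕ)) :=
          mul_le_mul ha hb (Real.sqrt_nonneg _) (Real.sqrt_nonneg _)
      _ = _ := Real.mul_self_sqrt (Nat.cast_nonneg _)
  rw [summable_mul_left_iff (inv_pos.2 hp).ne',
    summable_nat_add_iff (f := fun k : ℕ => ((k : ℕ) : ℝ)⁻¹) (i + j + 1)] at h1
  exact Real.not_summable_natCast_inv h1

set_option linter.unusedSectionVars false

variable {𝓗 : Type*} [NormedAddCommGroup 𝓗] [InnerProductSpace ℂ 𝓗] [CompleteSpace 𝓗]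

/-- The value of `ρ ↦ p (a† ρ a - ½ {a a†, ρ}) + q (a ρ a† - ½ {a† a, ρ})` at `|i⟩⟨j|`. The index
`i - 1` at `i = 0` is harmless, because it comes with the coefficient `√0`. -/
def ouUnit (b : HilbertBasis ℕ ℂ 𝓗) (p q : ℝ) (i j : ℕ) : TraceClass b :=
  ((p * (Real.sqrt (i + 1) * Real.sqrt (j + 1)) : ℝ) : ℂ) • TraceClass.unit b (i + 1) (j + 1) +
    ((q * (Real.sqrt i * Real.sqrt j) : ℝ) : ℂ) • TraceClass.unit b (i - 1) (j - 1) -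
    (((p * (i + j + 2) + q * (i + j)) / 2 : ℝ) : ℂ) • TraceClass.unit b i j

/-- The quantum Ornstein-Uhlenbeck operator on finite linear combinations of the `|i⟩⟨j|`. -/
def ouCore (b : HilbertBasis ℕ ℂ 𝓗) (p q : ℝ) : (ℕ × ℕ →₀ ℂ) →ₗ[ℂ] TraceClass b :=
  Finsupp.linearCombination ℂ fun ij => ouUnit b p q ij.1 ij.2

theorem ouCore_single (b : HilbertBasis ℕ ℂ 𝓗) (p q : ℝ) (i j : ℕ) (c : ℂ) :
    ouCore b p q (Finsupp.single (i, j) c) = c • ouUnit b p q i j := by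
  simp [ouCore]

theorem Real.sqrt_mul_sqrt_le_add_div_two {x y : ℝ} (hx : 0 ≤ x) (hy : 0 ≤ y) :
    Real.sqrt x * Real.sqrt y ≤ (x + y) / 2 := by
  nlinarith [sq_nonneg (Real.sqrt x - Real.sqrt y), Real.sq_sqrt hx, Real.sq_sqrt hy]

/-- A functional `φ` vanishing on the range of `z - L` has bounded values on the `|i⟩⟨j|`, which
along each diagonal `i - j = const` satisfy a three-term recursion without nonzero bounded
solutions. -/
theorem denseRange_smul_sub_ouCore (b : HilbertBasis ℕ ℂ 𝓗) {p q : ℝ} (hp : 0 < p) (hq : 0 ≤ q)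
    {z : ℂ} (hz : 0 < z.re) : DenseRange (z • TraceClass.ofFinsupp b - ouCore b p q) := by
  refine denseRange_of_forall_dual_eq_zero _ fun φ hφ => ?_
  have hrec : ∀ i j, z * φ (TraceClass.unit b i j) = φ (ouUnit b p q i j) := fun i j => by
    have h1 := hφ (Finsupp.single (i, j) 1)
    rw [LinearMap.sub_apply, LinearMap.smul_apply, TraceClass.ofFinsupp_single, ouCore_single,
      one_smul, one_smul, map_sub, map_smul, sub_eq_zero, smul_eq_mul] at h1
    exact h1
  simp only [ouUnit, map_sub, map_add, map_smul, smul_eq_mul] at hrec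
  -- Each diagonal starts at a matrix unit `|i⟩⟨j|` with `i = 0` or `j = 0`.
  have hdiag : ∀ i j, i = 0 ∨ j = 0 → ∀ k, φ (TraceClass.unit b (i + k) (j + k)) = 0 := by
    intro i j hij k
    have hnn : ∀ n : ℕ, (0 : ℝ) ≤ n := fun n => Nat.cast_nonneg n
    refine eq_zero_of_three_term_recursion (X := fun k => φ (TraceClass.unit b (i + k) (j + k)))
      (c := fun k => p * (Real.sqrt ((i + k : ℕ) + 1) * Real.sqrt ((j + k : ℕ) + 1)))
      (d := fun k => q * (Real.sqrt (i + k : ℕ) * Real.sqrt (j + k : ℕ)))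
      (s := fun k => (p * ((i + k : ℕ) + (j + k : ℕ) + 2) + q * ((i + k : ℕ) + (j + k : ℕ))) / 2)
      (C := ‖φ‖) hz (fun k => by positivity) (fun k => by positivity) (fun k => ?_) ?_ ?_
      (not_summable_inv_mul_sqrt_mul_sqrt hp i j) (fun k => ?_) k
    · have h1 := Real.sqrt_mul_sqrt_le_add_div_two (x := (i + k : ℕ) + 1) (y := (j + k : ℕ) + 1)
        (by positivity) (by positivity)
      have h2 := Real.sqrt_mul_sqrt_le_add_div_two (hnn (i + k)) (hnn (j + k))
      nlinarith
    · have h1 := hrec i j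
      have h2 : Real.sqrt i * Real.sqrt j = 0 := by
        rcases hij with rfl | rfl <;> simp
      rw [h2, mul_zero, Complex.ofReal_zero, zero_mul, add_zero] at h1
      rw [add_zero, add_zero, add_mul, h1]
      ring
    · intro k
      have h1 := hrec (i + (k + 1)) (j + (k + 1))
      have e1 : i + (k + 1) - 1 = i + k := by omega
      have e2 : j + (k + 1) - 1 = j + k := by omega
      rw [e1, e2] at h1
      rw [add_mul, h1]
      simp only [show i + (k + 1) + 1 = i + (k + 2) by omega,
        show j + (k + 1) + 1 = j + (k + 2) by omega]
      ring
    · exact (φ.le_opNorm _).trans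
        (mul_le_of_le_one_right (norm_nonneg _) (TraceClass.norm_unit_le b _ _))
  have hall : ∀ i j, φ (TraceClass.unit b i j) = 0 := fun i j => by
    have h1 := hdiag (i - min i j) (j - min i j) (by omega) (min i j)
    rwa [Nat.sub_add_cancel (min_le_left i j), Nat.sub_add_cancel (min_le_right i j)] at h1
  have h0 : ∀ v, φ (TraceClass.ofFinsupp b v) = 0 := fun v => by
    rw [TraceClass.ofFinsupp, Finsupp.linearCombination_apply, map_finsuppSum]
    simp [hall, Finsupp.sum]
  exact ContinuousLinearMap.ext fun x =>
    (TraceClass.denseRange_ofFinsupp b).induction_on (p := fun x => φ x = 0) x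
      (isClosed_eq φ.continuous continuous_const) h0

/-- The creation operator, cut off above level `M`. -/
def truncCreation (b : HilbertBasis ℕ ℂ 𝓗) (M : ℕ) : 𝓗 →L[ℂ] 𝓗 :=
  ∑ n ∈ Finset.range M, (Real.sqrt (n + 1) : ℂ) • InnerProductSpace.rankOne ℂ (b (n + 1)) (b n)

theorem truncCreation_apply (b : HilbertBasis ℕ ℂ 𝓗) {M n : ℕ} (hn : n < M) :
    truncCreation b M (b n) = (Real.sqrt (n + 1) : ℂ) • b (n + 1) := by
  have h := orthonormal_iff_ite.1 b.orthonormal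
  simp [truncCreation, sum_apply, h, ite_smul, Finset.sum_ite_eq', hn]

theorem star_truncCreation (b : HilbertBasis ℕ ℂ 𝓗) (M : ℕ) : star (truncCreation b M) =
    ∑ n ∈ Finset.range M,
      (Real.sqrt (n + 1) : ℂ) • InnerProductSpace.rankOne ℂ (b n) (b (n + 1)) := by
  simp [truncCreation, star_sum, star_rankOne]

theorem star_truncCreation_apply (b : HilbertBasis ℕ ℂ 𝓗) {M n : ℕ} (hn : n ≤ M) :
    star (truncCreation b M) (b n) = (Real.sqrt n : ℂ) • b (n - 1) := by
  have h := orthonormal_iff_ite.1 b.orthonormal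
  rw [star_truncCreation]
  cases n with
  | zero => simp [sum_apply, h]
  | succ n =>
    simp [sum_apply, h, ite_smul, Finset.sum_ite_eq', Nat.lt_of_succ_le hn]

theorem levelProj_mul_truncCreation (b : HilbertBasis ℕ ℂ 𝓗) (M : ℕ) :
    levelProj b (M + 1) * truncCreation b M = truncCreation b M := by
  rw [truncCreation, Finset.mul_sum]
  refine Finset.sum_congr rfl fun n hn => ?_
  refine ContinuousLinearMap.ext fun x => ?_
  simp only [mul_apply_eq_comp, smul_apply, InnerProductSpace.rankOne_apply, map_smul]
  rw [levelProj_apply_basis, if_pos (by simpa using hn)]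

theorem levelProj_mul_star_truncCreation (b : HilbertBasis ℕ ℂ 𝓗) (M : ℕ) :
    levelProj b (M + 1) * star (truncCreation b M) = star (truncCreation b M) := by
  rw [star_truncCreation, Finset.mul_sum]
  refine Finset.sum_congr rfl fun n hn => ?_
  refine ContinuousLinearMap.ext fun x => ?_
  simp only [mul_apply_eq_comp, smul_apply, InnerProductSpace.rankOne_apply, map_smul]
  rw [levelProj_apply_basis, if_pos (by have := Finset.mem_range.1 hn; omega)]

theorem mul_rankOne (V : 𝓗 →L[ℂ] 𝓗) (x y : 𝓗) :
    V * InnerProductSpace.rankOne ℂ x y = InnerProductSpace.rankOne ℂ (V x) y :=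
  ContinuousLinearMap.ext fun w => by simp

theorem rankOne_mul (V : 𝓗 →L[ℂ] 𝓗) (x y : 𝓗) :
    InnerProductSpace.rankOne ℂ x y * V = InnerProductSpace.rankOne ℂ x (star V y) := by
  rw [← star_inj, star_mul, star_rankOne, star_rankOne, mul_rankOne]

theorem dissipator_rankOne {V : 𝓗 →L[ℂ] 𝓗} {x y x' y' : 𝓗} {r s : ℝ}
    (hx : star V (V x) = (r : ℂ) • x) (hy : star V (V y) = (s : ℂ) • y)
    (hx' : V x = x') (hy' : V y = y') :
    dissipator V (InnerProductSpace.rankOne ℂ x y) = InnerProductSpace.rankOne ℂ x' y' -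
      (((r + s) / 2 : ℝ) : ℂ) • InnerProductSpace.rankOne ℂ x y := by
  rw [dissipator_apply, mul_rankOne, rankOne_mul, star_star, mul_rankOne, rankOne_mul, star_mul,
    star_star, mul_apply_eq_comp, mul_apply_eq_comp, hx, hy, hx', hy']
  simp only [map_smulₛₗ, smul_apply, Complex.conj_ofReal, RingHom.id_apply]
  rw [← add_smul, smul_smul]
  push_cast
  ring_nf

theorem toOp_ouUnit (b : HilbertBasis ℕ ℂ 𝓗) (p q : ℝ) {M i j : ℕ} (hi : i < M) (hj : j < M) :
    (ouUnit b p q i j).toOp = (p : ℂ) • dissipator (truncCreation b M)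
      (InnerProductSpace.rankOne ℂ (b i) (b j)) + (q : ℂ) • dissipator (star (truncCreation b M))
      (InnerProductSpace.rankOne ℂ (b i) (b j)) := by
  have h1 : ∀ {n}, n < M → star (truncCreation b M) (truncCreation b M (b n)) =
      ((n + 1 : ℝ) : ℂ) • b n := fun {n} hn => by
    rw [truncCreation_apply b hn, map_smul, star_truncCreation_apply b hn, smul_smul,
      ← Complex.ofReal_mul, Nat.cast_succ, Real.mul_self_sqrt (by positivity), Nat.succ_sub_one]
  have h2 : ∀ {n}, n < M → star (star (truncCreation b M)) (star (truncCreation b M) (b n)) =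
      ((n : ℝ) : ℂ) • b n := fun {n} hn => by
    rw [star_star, star_truncCreation_apply b hn.le, map_smul]
    cases n with
    | zero => simp
    | succ n =>
      rw [Nat.add_sub_cancel, truncCreation_apply b (by omega), smul_smul, ← Complex.ofReal_mul,
        Nat.cast_succ, Real.mul_self_sqrt (by positivity)]
  rw [dissipator_rankOne (h1 hi) (h1 hj) (truncCreation_apply b hi) (truncCreation_apply b hj),
    dissipator_rankOne (h2 hi) (h2 hj) (star_truncCreation_apply b hi.le)
      (star_truncCreation_apply b hj.le), ouUnit]
  simp only [map_sub, map_add, map_smul, TraceClass.toOp_unit, map_smulₛₗ, smul_apply,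
    Complex.conj_ofReal]
  push_cast
  module

theorem isMDissipativeCore_ou (b : HilbertBasis ℕ ℂ 𝓗) {p q : ℝ} (hp : 0 < p) (hq : 0 ≤ q) :
    IsMDissipativeCore (TraceClass.ofFinsupp b) (ouCore b p q) where
  dense := TraceClass.denseRange_ofFinsupp b
  denseRange_sub z hz := denseRange_smul_sub_ouCore b hp hq hz
  dissipative z _ v := by
    obtain ⟨M, hM⟩ : ∃ M, ∀ ij ∈ v.support, ij.1 < M ∧ ij.2 < M := by
      refine ⟨v.support.sup (fun ij => max ij.1 ij.2) + 1, fun ij h => ?_⟩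
      have := Finset.le_sup (f := fun ij : ℕ × ℕ => max ij.1 ij.2) h
      omega
    have hx : (TraceClass.ofFinsupp b v).toOp =
        ∑ ij ∈ v.support, v ij • InnerProductSpace.rankOne ℂ (b ij.1) (b ij.2) := by
      rw [TraceClass.ofFinsupp, Finsupp.linearCombination_apply, Finsupp.sum, map_sum]
      simp only [map_smul, TraceClass.toOp_unit]
    -- Jumps raise the level by at most one, so `M + 1` levels suffice.
    refine re_mul_norm_le_norm_smul_sub_of_dissipator (M := M + 1)
      (levelProj_mul_truncCreation b M) (levelProj_mul_star_truncCreation b M) hp.le hq ?_ ?_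
    · rw [hx, Finset.sum_mul]
      refine Finset.sum_congr rfl fun ij h => ?_
      rw [smul_mul_assoc, rankOne_mul, star_levelProj, levelProj_apply_basis,
        if_pos ((hM ij h).2.trans (Nat.lt_succ_self M))]
    · rw [hx, ouCore, Finsupp.linearCombination_apply, Finsupp.sum, map_sum, map_sum, map_sum,
        Finset.smul_sum, Finset.smul_sum, ← Finset.sum_add_distrib]
      refine Finset.sum_congr rfl fun ij h => ?_
      rw [map_smul, map_smul, map_smul, toOp_ouUnit b p q (hM ij h).1 (hM ij h).2, smul_add,
        smul_comm (v ij), smul_comm (v ij)]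

end OrnsteinUhlenbeck

/-! ### Eigenvectors in the open left half-plane -/

noncomputable section Eigenvectors

/-- The coefficients `(-1)ᵏ (w choose k)` of `(1 - s)ʷ`. -/
def binomialCoeff (w : ℂ) : ℕ → ℂ
  | 0 => 1
  | k + 1 => binomialCoeff w k * (k - w) / (k + 1)

theorem binomialCoeff_succ (w : ℂ) (k : ℕ) :
    binomialCoeff w (k + 1) * (k + 1) = binomialCoeff w k * (k - w) := by
  rw [binomialCoeff, div_mul_cancel₀]
  exact Nat.cast_add_one_ne_zero k

/-- The coefficients of `(1 - r s)^(-w-1)`. -/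
def geometricCoeff (r w : ℂ) : ℕ → ℂ
  | 0 => 1
  | k + 1 => geometricCoeff r w k * (r * (k + w + 1)) / (k + 1)

theorem geometricCoeff_succ (r w : ℂ) (k : ℕ) :
    geometricCoeff r w (k + 1) * (k + 1) = geometricCoeff r w k * (r * (k + w + 1)) := by
  rw [geometricCoeff, div_mul_cancel₀]
  exact Nat.cast_add_one_ne_zero k

/-- The coefficients of `(1 - s)ʷ` are absolutely summable for `Re w > 0`: eventually
`k |αₖ| - (k + 1) |αₖ₊₁| = (k - |k - w|) |αₖ| ≥ (Re w / 2) |αₖ|`. -/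
theorem summable_norm_binomialCoeff {w : ℂ} (hw : 0 < w.re) :
    Summable fun k => ‖binomialCoeff w k‖ := by
  obtain ⟨K, hK⟩ := exists_nat_gt ((w.re ^ 2 + w.im ^ 2) / w.re)
  rw [div_lt_iff₀ hw] at hK
  have hbound : ∀ k : ℕ, K ≤ k → ‖(k : ℂ) - w‖ ≤ k - w.re / 2 := fun k hk => by
    have hk' : (K : ℝ) ≤ k := Nat.cast_le.2 hk
    have h1 : w.re ^ 2 + w.im ^ 2 ≤ k * w.re := hK.le.trans (mul_le_mul_of_nonneg_right hk' hw.le)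
    have h2 : w.re ≤ k := by nlinarith [sq_nonneg w.im]
    refine abs_le_of_sq_le_sq' ?_ (by linarith) |>.2
    rw [Complex.sq_norm, Complex.normSq_apply]
    simp only [Complex.sub_re, Complex.natCast_re, Complex.sub_im, Complex.natCast_im]
    nlinarith
  have hstep : ∀ k : ℕ, K ≤ k → (k + 1 : ℝ) * ‖binomialCoeff w (k + 1)‖ ≤
      k * ‖binomialCoeff w k‖ - w.re / 2 * ‖binomialCoeff w k‖ := fun k hk => by
    have h1 := congrArg norm (binomialCoeff_succ w k)
    have h2 : ‖(k : ℂ) + 1‖ = k + 1 := by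
      rw [← Nat.cast_succ, Complex.norm_natCast, Nat.cast_succ]
    rw [norm_mul, norm_mul, h2] at h1
    rw [mul_comm, h1]
    nlinarith [mul_le_mul_of_nonneg_left (hbound k hk) (norm_nonneg (binomialCoeff w k))]
  have hsum : ∀ n, w.re / 2 * ∑ k ∈ Finset.range n, ‖binomialCoeff w (k + K)‖ ≤
      K * ‖binomialCoeff w K‖ - (n + K : ℕ) * ‖binomialCoeff w (n + K)‖ := fun n => by
    induction n with
    | zero => simp
    | succ n ih =>
      rw [Finset.sum_range_succ, mul_add]
      have h1 := hstep (n + K) (Nat.le_add_left K n)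
      rw [show n + 1 + K = n + K + 1 by omega]
      push_cast at h1 ih ⊢
      linarith
  rw [← summable_nat_add_iff K]
  refine summable_of_sum_range_le (c := K * ‖binomialCoeff w K‖ / (w.re / 2))
    (fun _ => norm_nonneg _) fun n => ?_
  rw [le_div_iff₀ (half_pos hw), mul_comm]
  exact (hsum n).trans (sub_le_self _ (by positivity))

theorem summable_norm_geometricCoeff {r : ℂ} (hr : ‖r‖ < 1) (w : ℂ) :
    Summable fun k => ‖geometricCoeff r w k‖ := by
  obtain ⟨ρ, hρ1, hρ2⟩ := exists_between hr
  refine (summable_of_ratio_norm_eventually_le (f := geometricCoeff r w) hρ2 ?_).norm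
  have h1 : Tendsto (fun k : ℕ => ‖r‖ * (1 + ‖w‖ * (1 / ((k : ℝ) + 1)))) atTop
      (𝓝 (‖r‖ * (1 + ‖w‖ * 0))) :=
    ((tendsto_one_div_add_atTop_nhds_zero_nat.const_mul _).const_add _).const_mul _
  rw [mul_zero, add_zero, mul_one] at h1
  filter_upwards [h1.eventually (gt_mem_nhds hρ1)] with k hk
  have hk0 : (0 : ℝ) < k + 1 := by positivity
  have h2 : ‖(k : ℂ) + 1‖ = k + 1 := by
    rw [← Nat.cast_succ, Complex.norm_natCast, Nat.cast_succ]
  have h3 : ‖(k : ℂ) + w + 1‖ ≤ k + 1 + ‖w‖ := by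
    rw [add_right_comm]
    exact (norm_add_le _ _).trans_eq (by rw [h2])
  rw [geometricCoeff, norm_div, norm_mul, norm_mul, h2, div_le_iff₀ hk0]
  have h4 : ‖r‖ * (k + 1 + ‖w‖) ≤ ρ * (k + 1) := by
    have : ‖r‖ * (k + 1 + ‖w‖) = ‖r‖ * (1 + ‖w‖ * (1 / ((k : ℝ) + 1))) * (k + 1) := by
      field_simp
    rw [this]
    exact mul_le_mul_of_nonneg_right hk.le hk0.le
  calc ‖geometricCoeff r w k‖ * (‖r‖ * ‖(k : ℂ) + w + 1‖)
      ≤ ‖geometricCoeff r w k‖ * (ρ * (k + 1)) := by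
        exact mul_le_mul_of_nonneg_left
          ((mul_le_mul_of_nonneg_left h3 (norm_nonneg _)).trans h4) (norm_nonneg _)
    _ = ρ * ‖geometricCoeff r w k‖ * (k + 1) := by ring

/-- The birth-death recursion `z xₙ = p n xₙ₋₁ + q (n + 1) xₙ₊₁ - (p (n + 1) + q n) xₙ` with
`0 < p < q` has an absolutely summable solution when `Re z < 0`. Its generating function `F` solves
`(1 - s) (q - p s) F' = (z + p - p s) F`, so that
`F = (1 - s)ʷ (1 - (p / q) s)^(-w-1)` with `w = -z / (q - p)`. -/
theorem exists_summable_eigenvector {p q : ℝ} (hp : 0 < p) (hpq : p < q) {z : ℂ} (hz : z.re < 0) :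
    ∃ x : ℕ → ℂ, x 0 ≠ 0 ∧ Summable (fun n => ‖x n‖) ∧ q * x 1 = (z + p) * x 0 ∧
      ∀ n : ℕ, (q * (n + 2)) * x (n + 2) =
        (z + p * (n + 2) + q * (n + 1)) * x (n + 1) - p * (n + 1) * x n := by
  have hq : 0 < q := hp.trans hpq
  have hqp : (q - p : ℂ) ≠ 0 := by
    rw [← Complex.ofReal_sub]; exact Complex.ofReal_ne_zero.2 (sub_pos.2 hpq).ne'
  have hq0 : (q : ℂ) ≠ 0 := Complex.ofReal_ne_zero.2 hq.ne'
  set w : ℂ := -z / (q - p) with hwdef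
  have hw : w * (q - p) = -z := div_mul_cancel₀ _ hqp
  have hwre : 0 < w.re := by
    have : w = ((q - p : ℝ) : ℂ)⁻¹ * (-z) := by
      rw [hwdef, div_eq_inv_mul, Complex.ofReal_sub]
    rw [this, ← Complex.ofReal_inv, Complex.re_ofReal_mul, Complex.neg_re]
    exact mul_pos (inv_pos.2 (sub_pos.2 hpq)) (neg_pos.2 hz)
  set r : ℂ := p / q with hr
  have hrq : q * r = p := by rw [hr, mul_div_cancel₀ _ hq0]
  have hr1 : ‖r‖ < 1 := by
    rw [hr, ← Complex.ofReal_div, Complex.norm_real, Real.norm_of_nonneg (by positivity)]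
    exact (div_lt_one hq).2 hpq
  let A : PowerSeries ℂ := PowerSeries.mk (binomialCoeff w)
  let G : PowerSeries ℂ := PowerSeries.mk (geometricCoeff r w)
  let F := A * G
  have hA : (1 - PowerSeries.X) * PowerSeries.derivative ℂ A = -(PowerSeries.C w * A) := by
    ext k
    rw [sub_mul, one_mul, map_sub, map_neg, PowerSeries.coeff_C_mul, PowerSeries.coeff_derivative,
      PowerSeries.coeff_mk, binomialCoeff_succ, PowerSeries.coeff_mk]
    cases k with
    | zero => rw [PowerSeries.coeff_zero_X_mul]; simp; ring
    | succ k =>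
      rw [PowerSeries.coeff_succ_X_mul, PowerSeries.coeff_derivative, PowerSeries.coeff_mk]
      push_cast
      ring
  have hG : (PowerSeries.C (q : ℂ) - PowerSeries.C (p : ℂ) * PowerSeries.X) *
      PowerSeries.derivative ℂ G = PowerSeries.C (p * (w + 1)) * G := by
    ext k
    rw [sub_mul, map_sub, mul_assoc, PowerSeries.coeff_C_mul, PowerSeries.coeff_C_mul,
      PowerSeries.coeff_C_mul, PowerSeries.coeff_derivative,
      PowerSeries.coeff_mk, geometricCoeff_succ, PowerSeries.coeff_mk, ← hrq]
    cases k with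
    | zero => rw [PowerSeries.coeff_zero_X_mul]; simp; ring
    | succ k =>
      rw [PowerSeries.coeff_succ_X_mul, PowerSeries.coeff_derivative, PowerSeries.coeff_mk]
      push_cast
      ring
  have hF : (1 - PowerSeries.X) * ((PowerSeries.C (q : ℂ) - PowerSeries.C (p : ℂ) * PowerSeries.X) *
      PowerSeries.derivative ℂ F) =
      (PowerSeries.C (z + p) - PowerSeries.C (p : ℂ) * PowerSeries.X) * F := by
    have h1 : PowerSeries.derivative ℂ F =
        A * PowerSeries.derivative ℂ G + G * PowerSeries.derivative ℂ A := by
      simp only [F, Derivation.leibniz, smul_eq_mul]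
    have h2 : (PowerSeries.C (z + p) : PowerSeries ℂ) = PowerSeries.C (p * (w + 1)) -
        PowerSeries.C w * PowerSeries.C (q : ℂ) := by
      rw [← map_mul, ← map_sub]
      congr 1
      linear_combination hw
    have h3 : (PowerSeries.C (p * (w + 1)) : PowerSeries ℂ) =
        PowerSeries.C (p : ℂ) * (PowerSeries.C w + 1) := by
      rw [map_mul, map_add, map_one]
    rw [h1, h2]
    rw [h3] at hG ⊢
    simp only [F]
    linear_combination (1 - PowerSeries.X) * A * hG +
      (PowerSeries.C (q : ℂ) - PowerSeries.C (p : ℂ) * PowerSeries.X) * G * hA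
  have hcoeff : ∀ n, PowerSeries.coeff n F = ∑ kl ∈ Finset.HasAntidiagonal.antidiagonal n,
      binomialCoeff w kl.1 * geometricCoeff r w kl.2 := fun n => by
    simp only [F, A, G, PowerSeries.coeff_mul, PowerSeries.coeff_mk]
  refine ⟨fun n => PowerSeries.coeff n F, ?_, ?_, ?_, fun n => ?_⟩
  · simp [hcoeff, binomialCoeff, geometricCoeff]
  · simp only [hcoeff]
    exact summable_norm_sum_mul_antidiagonal_of_summable_norm (summable_norm_binomialCoeff hwre)
      (summable_norm_geometricCoeff hr1 w)
  · have h1 := congrArg (PowerSeries.coeff 0) hF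
    simp only [sub_mul, one_mul, map_sub, PowerSeries.coeff_zero_X_mul, mul_assoc,
      PowerSeries.coeff_C_mul, PowerSeries.coeff_derivative] at h1
    simpa using h1
  · have h1 := congrArg (PowerSeries.coeff (n + 1)) hF
    simp only [sub_mul, one_mul, map_sub, PowerSeries.coeff_succ_X_mul, mul_assoc,
      PowerSeries.coeff_C_mul, PowerSeries.coeff_derivative] at h1
    cases n with
    | zero =>
      rw [PowerSeries.coeff_zero_X_mul] at h1
      push_cast at h1 ⊢
      linear_combination h1
    | succ n =>
      rw [PowerSeries.coeff_succ_X_mul, PowerSeries.coeff_derivative] at h1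
      push_cast at h1 ⊢
      linear_combination h1

theorem frequently_mul_lt_of_summable {y : ℕ → ℝ} (hy : Summable y) {ε : ℝ} (hε : 0 < ε) :
    ∃ᶠ n : ℕ in atTop, (n + 1) * y n < ε := by
  intro h
  have h1 : ∀ᶠ n : ℕ in atTop, ‖ε * ((n + 1 : ℕ) : ℝ)⁻¹‖ ≤ y n := h.mono fun n hn => by
    rw [Real.norm_of_nonneg (by positivity), ← div_eq_mul_inv, div_le_iff₀ (by positivity)]
    push_cast
    linarith [not_lt.1 hn]
  have h2 := Summable.of_norm_bounded_eventually_nat hy h1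
  rw [summable_mul_left_iff hε.ne',
    summable_nat_add_iff (f := fun k : ℕ => ((k : ℕ) : ℝ)⁻¹) 1] at h2
  exact Real.not_summable_natCast_inv h2

set_option linter.unusedSectionVars false

variable {𝓗 : Type*} [NormedAddCommGroup 𝓗] [InnerProductSpace ℂ 𝓗] [CompleteSpace 𝓗]

theorem ouUnit_diag (b : HilbertBasis ℕ ℂ 𝓗) (p q : ℝ) (n : ℕ) : ouUnit b p q n n =
    (p * (n + 1) : ℂ) • TraceClass.unit b (n + 1) (n + 1) +
    (q * n : ℂ) • TraceClass.unit b (n - 1) (n - 1) -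
    (p * (n + 1) + q * n : ℂ) • TraceClass.unit b n n := by
  rw [ouUnit, Real.mul_self_sqrt (by positivity), Real.mul_self_sqrt (by positivity)]
  push_cast
  congr 2
  ring

/-- The truncation of `∑ xₙ |n⟩⟨n|` to the levels `0, …, M`. -/
def diagTrunc (x : ℕ → ℂ) (M : ℕ) : ℕ × ℕ →₀ ℂ :=
  ∑ n ∈ Finset.range (M + 1), Finsupp.single (n, n) (x n)

/-- Truncated formal eigenvectors satisfy the eigenvalue equation up to a boundary term. -/
theorem ouCore_diagTrunc (b : HilbertBasis ℕ ℂ 𝓗) {p q : ℝ} {z : ℂ} {x : ℕ → ℂ}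
    (h0 : q * x 1 = (z + p) * x 0) (h1 : ∀ n : ℕ, (q * (n + 2)) * x (n + 2) =
      (z + p * (n + 2) + q * (n + 1)) * x (n + 1) - p * (n + 1) * x n) (M : ℕ) :
    ouCore b p q (diagTrunc x M) = z • TraceClass.ofFinsupp b (diagTrunc x M) +
      (p * (M + 1) * x M) • TraceClass.unit b (M + 1) (M + 1) -
      (q * (M + 1) * x (M + 1)) • TraceClass.unit b M M := by
  induction M with
  | zero =>
    have e : diagTrunc x 0 = Finsupp.single (0, 0) (x 0) := by simp [diagTrunc]
    rw [e, ouCore_single, TraceClass.ofFinsupp_single, ouUnit_diag]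
    push_cast
    rw [mul_zero, zero_add, mul_one, mul_one, h0]
    module
  | succ M ih =>
    have e : diagTrunc x (M + 1) = diagTrunc x M + Finsupp.single (M + 1, M + 1) (x (M + 1)) := by
      rw [diagTrunc, Finset.sum_range_succ]; rfl
    have h2 : (q : ℂ) * (((M + 1 : ℕ) : ℂ) + 1) * x (M + 1 + 1) =
        (z + p * (M + 2) + q * (M + 1)) * x (M + 1) - p * (M + 1) * x M := by
      rw [← h1]; push_cast; ring
    rw [e, map_add, map_add, ih, ouCore_single, TraceClass.ofFinsupp_single, ouUnit_diag, h2,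
      Nat.add_sub_cancel]
    push_cast
    module

theorem norm_inner_le_norm_traceClass {b : HilbertBasis ℕ ℂ 𝓗} (T : TraceClass b) (i j : ℕ) :
    ‖⟪b i, T.toOp (b j)⟫_ℂ‖ ≤ ‖T‖ := by
  refine (norm_inner_le_norm _ _).trans ?_
  rw [b.orthonormal.1 i, one_mul]
  refine (T.toOp.le_of_opNorm_le (TraceClass.norm_toOp_le T) _).trans_eq ?_
  rw [b.orthonormal.1 j, mul_one]

/-- Every `z` with `Re z < 0` is an eigenvalue of the closure of the Ornstein-Uhlenbeck operator.
The boundary terms of the truncations have norm at most `(M + 1) (p |x_M| + q |x_{M+1}|)`, which is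
arbitrarily small for suitable large `M`, because `∑ 1 / (M + 1)` diverges. -/
theorem exists_eigenvector_mem_closure (b : HilbertBasis ℕ ℂ 𝓗) {p q : ℝ} (hp : 0 < p)
    (hpq : p < q) {z : ℂ} (hz : z.re < 0) :
    ∃ T : TraceClass b, T ≠ 0 ∧
      (T, z • T) ∈ closure (Set.range fun v => (TraceClass.ofFinsupp b v, ouCore b p q v)) := by
  obtain ⟨x, hx0, hx, h0, h1⟩ := exists_summable_eigenvector hp hpq hz
  have hq : 0 < q := hp.trans hpq
  have hsum : Summable fun n => x n • TraceClass.unit b n n := by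
    refine Summable.of_norm (Summable.of_nonneg_of_le (fun _ => norm_nonneg _) (fun n => ?_) hx)
    rw [norm_smul]
    exact mul_le_of_le_one_right (norm_nonneg _) (TraceClass.norm_unit_le b n n)
  have hιv : ∀ M, TraceClass.ofFinsupp b (diagTrunc x M) =
      ∑ n ∈ Finset.range (M + 1), x n • TraceClass.unit b n n := fun M => by
    rw [diagTrunc, map_sum]
    exact Finset.sum_congr rfl fun n _ => TraceClass.ofFinsupp_single b n n _
  set T := ∑' n, x n • TraceClass.unit b n n
  have hlim : Tendsto (fun M => TraceClass.ofFinsupp b (diagTrunc x M)) atTop (𝓝 T) := by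
    simp_rw [hιv]
    exact hsum.hasSum.tendsto_sum_nat.comp (tendsto_add_atTop_nat 1)
  refine ⟨T, fun hT => ?_, ?_⟩
  · have h2 : ∀ M, ‖x 0‖ ≤ ‖TraceClass.ofFinsupp b (diagTrunc x M)‖ := fun M => by
      have h3 := norm_inner_le_norm_traceClass (TraceClass.ofFinsupp b (diagTrunc x M)) 0 0
      have ho := orthonormal_iff_ite.1 b.orthonormal
      have h4 : ⟪b 0, (TraceClass.ofFinsupp b (diagTrunc x M)).toOp (b 0)⟫_ℂ = x 0 := by
        rw [hιv, map_sum]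
        simp [map_smul, TraceClass.toOp_unit, sum_apply, ho, b.orthonormal.1 0]
      rwa [h4] at h3
    have h3 := ge_of_tendsto' hlim.norm h2
    rw [hT, norm_zero] at h3
    exact hx0 (norm_le_zero_iff.1 h3)
  · rw [Metric.mem_closure_iff]
    intro ε hε
    have hy : Summable fun n => p * ‖x n‖ + q * ‖x (n + 1)‖ :=
      (hx.mul_left p).add (((summable_nat_add_iff 1).2 hx).mul_left q)
    have hev : ∀ᶠ M in atTop, (1 + ‖z‖) * ‖TraceClass.ofFinsupp b (diagTrunc x M) - T‖ < ε / 2 := by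
      have h2 := ((hlim.sub_const T).norm).const_mul (1 + ‖z‖)
      rw [sub_self, norm_zero, mul_zero] at h2
      exact h2.eventually (gt_mem_nhds (half_pos hε))
    obtain ⟨M, hM1, hM2⟩ :=
      ((frequently_mul_lt_of_summable hy (half_pos hε)).and_eventually hev).exists
    refine ⟨_, ⟨diagTrunc x M, rfl⟩, ?_⟩
    set ιv := TraceClass.ofFinsupp b (diagTrunc x M)
    have hzn : 0 ≤ ‖z‖ * ‖ιv - T‖ := by positivity
    rw [dist_comm, Prod.dist_eq, max_lt_iff]
    constructor
    · rw [dist_eq_norm]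
      linarith
    · rw [dist_eq_norm]
      change ‖ouCore b p q (diagTrunc x M) - z • T‖ < ε
      rw [ouCore_diagTrunc b h0 h1]
      set u := (p * (M + 1) * x M : ℂ) • TraceClass.unit b (M + 1) (M + 1)
      set u' := (q * (M + 1) * x (M + 1) : ℂ) • TraceClass.unit b M M
      have hM : ‖(M : ℂ) + 1‖ = M + 1 := by
        rw [← Nat.cast_succ, Complex.norm_natCast, Nat.cast_succ]
      have hu : ‖u‖ ≤ p * (M + 1) * ‖x M‖ := by
        rw [norm_smul, norm_mul, norm_mul, hM, Complex.norm_real, Real.norm_of_nonneg hp.le]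
        exact mul_le_of_le_one_right (by positivity) (TraceClass.norm_unit_le b _ _)
      have hu' : ‖u'‖ ≤ q * (M + 1) * ‖x (M + 1)‖ := by
        rw [norm_smul, norm_mul, norm_mul, hM, Complex.norm_real, Real.norm_of_nonneg hq.le]
        exact mul_le_of_le_one_right (by positivity) (TraceClass.norm_unit_le b _ _)
      have e : z • ιv + u - u' - z • T = z • (ιv - T) + u - u' := by rw [smul_sub]; abel
      rw [e]
      have h2 := norm_sub_le (z • (ιv - T) + u) u'
      have h3 := norm_add_le (z • (ιv - T)) u
      rw [norm_smul] at h3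
      nlinarith [norm_nonneg (ιv - T)]

end Eigenvectors

/-! ### The Gibbs sampler generator and its spectrum -/

noncomputable section GibbsSampler

set_option linter.unusedSectionVars false

theorem annihilation_single (i : ℕ) (c : ℂ) :
    annihilation (Finsupp.single i c) = Finsupp.single (i - 1) (c * Real.sqrt i) := by
  simp [annihilation]

theorem creation_single (i : ℕ) (c : ℂ) :
    creation (Finsupp.single i c) = Finsupp.single (i + 1) (c * Real.sqrt (i + 1)) := by
  simp [creation]

theorem filteredJump_annihilation (f : ℝ → ℂ) (i : ℕ) :
    filteredJump f annihilation i = Finsupp.single (i - 1) (f (-1) * Real.sqrt i) := by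
  rw [filteredJump, annihilation_single, one_mul, Finsupp.sum_single_index (by simp)]
  cases i with
  | zero => simp
  | succ i =>
    congr 3
    push_cast [Nat.succ_sub_one]
    ring

theorem filteredJump_creation (f : ℝ → ℂ) (i : ℕ) :
    filteredJump f creation i = Finsupp.single (i + 1) (f 1 * Real.sqrt (i + 1)) := by
  rw [filteredJump, creation_single, one_mul, Finsupp.sum_single_index (by simp)]
  congr 3
  push_cast
  ring

theorem driftTerm_annihilation (β : ℝ) (f : ℝ → ℂ) (i : ℕ) :
    driftTerm β f annihilation creation i =
      Finsupp.single i ((-(‖f (-1)‖ ^ 2 * i / 2) : ℝ) : ℂ) := by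
  rw [driftTerm, annihilation_single, one_mul, Finsupp.sum_single_index (by simp),
    creation_single, Finsupp.sum_single_index (by simp)]
  cases i with
  | zero => simp
  | succ i =>
    rw [Nat.succ_sub_one, ← Finsupp.single_neg]
    congr 1
    have e1 : (i : ℝ) - ((i + 1 : ℕ) : ℝ) = -1 := by push_cast; ring
    rw [e1, sub_self, mul_zero, zero_div, Real.exp_zero, Real.cosh_zero, Complex.conj_mul',
      Nat.cast_succ, ← Complex.ofReal_mul, Real.mul_self_sqrt (by positivity)]
    push_cast
    ring

theorem driftTerm_creation (β : ℝ) (f : ℝ → ℂ) (i : ℕ) :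
    driftTerm β f creation annihilation i =
      Finsupp.single i ((-(‖f 1‖ ^ 2 * (i + 1) / 2) : ℝ) : ℂ) := by
  rw [driftTerm, creation_single, one_mul, Finsupp.sum_single_index (by simp),
    annihilation_single, Finsupp.sum_single_index (by simp), Nat.add_sub_cancel,
    ← Finsupp.single_neg]
  congr 1
  have e1 : ((i + 1 : ℕ) : ℝ) - (i : ℝ) = 1 := by push_cast; ring
  rw [e1, sub_self, mul_zero, zero_div, Real.exp_zero, Real.cosh_zero, Complex.conj_mul',
    Nat.cast_succ, ← Complex.ofReal_mul, Real.mul_self_sqrt (by positivity)]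
  push_cast
  ring

variable {𝓗 : Type*} [NormedAddCommGroup 𝓗] [InnerProductSpace ℂ 𝓗] [CompleteSpace 𝓗]

theorem fockVector_single (b : HilbertBasis ℕ ℂ 𝓗) (n : ℕ) (c : ℂ) :
    fockVector b (Finsupp.single n c) = c • b n := by
  simp [fockVector]

theorem toOp_ouUnit_eq_gibbsLindbladian (b : HilbertBasis ℕ ℂ 𝓗) (β : ℝ) (f : ℝ → ℂ) (i j : ℕ) :
    (ouUnit b (‖f 1‖ ^ 2) (‖f (-1)‖ ^ 2) i j).toOp = gibbsLindbladian b β f i j := by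
  have e : ∀ (c : ℂ) (r s : ℝ), c * r * (conj c * s) = ((‖c‖ ^ 2 * (r * s) : ℝ) : ℂ) :=
    fun c r s => by
      rw [mul_mul_mul_comm, Complex.mul_conj']
      push_cast
      ring
  rw [gibbsLindbladian, filteredJump_annihilation, filteredJump_annihilation,
    filteredJump_creation, filteredJump_creation, drift, drift, driftTerm_annihilation,
    driftTerm_annihilation, driftTerm_creation, driftTerm_creation, ← Finsupp.single_add,
    ← Finsupp.single_add]
  simp only [fockVector_single, map_smulₛₗ, smul_apply, RingHom.id_apply, ouUnit, map_sub, map_add,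
    TraceClass.toOp_unit, smul_smul, map_mul, Complex.conj_ofReal]
  have e' : ∀ (c : ℂ) (r s : ℝ), conj c * s * (c * r) = ((‖c‖ ^ 2 * (r * s) : ℝ) : ℂ) :=
    fun c r s => by rw [mul_comm, e]
  rw [e', e']
  push_cast
  module

theorem IsKMSFilter.norm_lt {β : ℝ} {f : ℝ → ℂ} (hf : IsKMSFilter β f) (hβ : 0 < β)
    (hf1 : f 1 ≠ 0) : ‖f 1‖ < ‖f (-1)‖ := by
  have h1 := congrArg norm (hf.symm 1)
  rw [RCLike.norm_conj, norm_mul, Complex.norm_real, Real.norm_of_nonneg (Real.exp_pos _).le] at h1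
  have h2 : Real.exp (-(β * 1 / 2)) < 1 := 
    (Real.exp_lt_exp.2 (by linarith)).trans_eq Real.exp_zero
  have h3 : 0 < ‖f 1‖ := norm_pos_iff.2 hf1
  have h4 : 0 < ‖f (-1)‖ := by
    by_contra h
    rw [le_antisymm (not_lt.1 h) (norm_nonneg _), zero_mul] at h1
    exact h3.ne' h1
  rw [h1]
  exact mul_lt_of_lt_one_right h4 h2

theorem isQuantumOUSemigroup_iff (b : HilbertBasis ℕ ℂ 𝓗) (β : ℝ) (f : ℝ → ℂ)
    (Ψ : C0Semigroup (TraceClass b)) : IsQuantumOUSemigroup b β f Ψ ↔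
      ∀ v, Ψ.HasDerivAtZero (TraceClass.ofFinsupp b v)
        (ouCore b (‖f 1‖ ^ 2) (‖f (-1)‖ ^ 2) v) := by
  constructor
  · intro h v
    induction v using Finsupp.induction_linear with
    | zero =>
      rw [map_zero, map_zero]
      simp [C0Semigroup.HasDerivAtZero]
    | add v w hv hw =>
      rw [map_add, map_add]
      exact hv.add hw
    | single ij c =>
      obtain ⟨x, hx, hy⟩ := h ij.1 ij.2
      rw [← toOp_ouUnit_eq_gibbsLindbladian] at hy
      rw [← TraceClass.toOp_unit] at hx
      rw [TraceClass.ofFinsupp_single b ij.1 ij.2, ouCore_single b _ _ ij.1 ij.2,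
        ← TraceClass.toOp_injective hx, ← TraceClass.toOp_injective hy]
      exact (Ψ.generator_spec x).smul c
  · intro h i j
    have h1 := h (Finsupp.single (i, j) 1)
    rw [TraceClass.ofFinsupp_single, ouCore_single, one_smul, one_smul] at h1
    obtain ⟨hx, hy⟩ := h1.exists_generator_eq
    exact ⟨⟨_, hx⟩, TraceClass.toOp_unit b i j, by rw [hy, toOp_ouUnit_eq_gibbsLindbladian]⟩

end GibbsSampler

theorem mainTheorem4 {𝓗 : Type*} [NormedAddCommGroup 𝓗] [InnerProductSpace ℂ 𝓗]
    [CompleteSpace 𝓗] (b : HilbertBasis ℕ ℂ 𝓗) (β : ℝ) (hβ : 0 < β) (f : ℝ → ℂ)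
    (hf : IsKMSFilter β f) (hf1 : f 1 ≠ 0) :
    ∃ Φ : C0Semigroup (TraceClass b),
      (∀ t, ‖Φ.op t‖ ≤ 1) ∧
      IsQuantumOUSemigroup b β f Φ ∧
      (∀ Ψ : C0Semigroup (TraceClass b), IsQuantumOUSemigroup b β f Ψ → Ψ = Φ) ∧
      unboundedSpectrum Φ.generator = {z : ℂ | z.re ≤ 0} ∧
      ¬ HasSpectralGap Φ.generator := by
  have hp : 0 < ‖f 1‖ ^ 2 := by have := norm_pos_iff.2 hf1; positivity
  have hpq : ‖f 1‖ ^ 2 < ‖f (-1)‖ ^ 2 :=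
    pow_lt_pow_left₀ (hf.norm_lt hβ hf1) (norm_nonneg _) two_ne_zero
  have h := isMDissipativeCore_ou b hp (hp.trans hpq).le
  have hspec : unboundedSpectrum h.semigroup.generator = {z : ℂ | z.re ≤ 0} := by
    ext z
    constructor
    · intro hz
      by_contra hre
      exact hz (h.mem_unboundedResolventSet (not_le.1 hre))
    · rintro (hz : z.re ≤ 0) ⟨B, -, hB⟩
      -- An eigenvector `T` for `z - ε` satisfies `T = -ε B T`.
      set ε : ℝ := (‖B‖ + 1)⁻¹ with hεdef
      have hε : 0 < ε := by positivity
      obtain ⟨T, hT0, hT⟩ := exists_eigenvector_mem_closure b hp hpq (z := z - ε) (by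
        rw [Complex.sub_re, Complex.ofReal_re]; linarith)
      have hmem : h.semigroup.HasDerivAtZero T ((z - ε) • T) :=
        closure_minimal (by rintro _ ⟨v, rfl⟩; exact h.hasDerivAtZero_semigroup v)
          h.semigroup.isClosed_hasDerivAtZero hT
      obtain ⟨hx, hy⟩ := hmem.exists_generator_eq
      have h1 := hB ⟨T, hx⟩
      rw [hy, sub_smul, sub_sub_cancel_left, map_neg, map_smul] at h1
      have h2 : ‖T‖ ≤ ε * (‖B‖ * ‖T‖) := by
        conv_lhs => rw [← show -((ε : ℂ) • B T) = T from h1]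
        rw [norm_neg, norm_smul, Complex.norm_real, Real.norm_of_nonneg hε.le]
        exact mul_le_mul_of_nonneg_left (B.le_opNorm T) hε.le
      have h3 : ε * ‖B‖ < 1 := by
        rw [hεdef, inv_mul_lt_iff₀ (by positivity)]; linarith
      have h4 : 0 < ‖T‖ := norm_pos_iff.2 hT0
      nlinarith
  refine ⟨h.semigroup, fun t => ?_, ?_, fun Ψ hΨ => ?_, hspec, ?_⟩
  · exact ContinuousLinearMap.opNorm_le_bound _ zero_le_one fun x => by
      rw [one_mul]; exact h.norm_semigroup_apply_le t x
  · exact (isQuantumOUSemigroup_iff b β f _).2 h.hasDerivAtZero_semigroup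
  · exact h.eq_semigroup ((isQuantumOUSemigroup_iff b β f Ψ).1 hΨ)
  · rintro ⟨c, hc, hgap⟩
    have h1 := hgap ((c / 2 : ℝ) : ℂ) ⟨by
      rw [hspec, Set.mem_ofPred_eq, Complex.ofReal_re]; linarith, by
      rw [Set.mem_singleton_iff, Complex.ofReal_eq_zero]; linarith⟩
    rw [Complex.ofReal_re] at h1
    linarith
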